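/- Let $M$ be a von Neumann algebra with a faithful normal tracial state $\varphi$. Let $X,Y\in M$ be self-adjoint, positive and invertible, free with respect to $\varphi$, and non-degenerate (their distributions are not point masses). Set $U=(X+Y)^{-1}$ and $V=X^{-1}-(X+Y)^{-1}$, and let $\varphi(\cdot\,|\,U)$ be the $\varphi$-preserving conditional expectation of $M$ onto the von Neumann subalgebra generated by $U$ and the identity $\mathbb I$. Assume that for some real constants $c,d$ $$\varphi(V\,|\,U)=c\,\mathbb I,\qquad \varphi(V^{-1}\,|\,U)=d\,\mathbb I .$$ Then $cd>1$, $\delta_0:=\varphi(Y^{-1})>0$, and with $$\lambda=\frac{cd}{cd-1},\qquad \alpha=\frac{\delta_0}{cd-1},\qquad \beta=\frac{d}{cd-1}$$ (so that $\lambda>1$ and $\alpha,\beta>0$) the following hold. (i) $Y$ has the free Poisson (Marchenko--Pastur) distribution with rate $\lambda$ and jump size $1/\alpha$. Here the free Poisson distribution with rate $\lambda\ge 0$ and jump size $\gamma>0$ is the measure $\max\{0,1-\lambda\}\,\delta_{\{0\}}+\tilde\nu$, where $\delta_{\{0\}}$ is the unit mass at $0$ and $\tilde\nu$ is the measure on $\left(\gamma(1-\sqrt\lambda)^2,\gamma(1+\sqrt\lambda)^2\right)$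 with density $\frac{1}{2\pi\gamma x}\sqrt{4\lambda\gamma^2-(x-\gamma(1+\lambda))^2}$. (ii) $X$ has the free GIG distribution $\mu(-\lambda,\alpha,\beta)$. Here, for $\kappa\in\mathbb R$ and $\alpha,\beta>0$, $\mu(\kappa,\alpha,\beta)$ is the measure on $[a,b]$ with density $$\frac{1}{2\pi}\sqrt{(x-a)(b-x)}\left(\frac{\alpha}{x}+\frac{\beta}{\sqrt{ab}\,x^2}\right),$$ where $0<a<b$ solve $$1-\kappa+\alpha\sqrt{ab}-\beta\,\frac{a+b}{2ab}=0,\qquad 1+\kappa+\frac{\beta}{\sqrt{ab}}-\alpha\,\frac{a+b}{2}=0 .$$ The distribution of a self-adjoint $Z\in M$ is the compactly supported probability measure on $\mathbb R$ whose $n$-th moment is $\varphi(Z^n)$ for every $n\ge 0$. -/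

import Mathlib

open MeasureTheory
open scoped ComplexOrder

noncomputable section

namespace FreeMY

section State

variable {A : Type*} [Ring A] [StarRing A] [Algebra ℂ A] [PartialOrder A]

/-- A faithful normal tracial state. Normality is preservation of suprema of increasing nets
of positive elements. -/
structure IsFaithfulNormalTracialState (φ : A →ₗ[ℂ] ℂ) : Prop where
  map_one : φ 1 = 1
  nonneg : ∀ a : A, 0 ≤ a → 0 ≤ φ a
  faithful : ∀ a : A, φ (star a * a) = 0 → a = 0
  tracial : ∀ a b : A, φ (a * b) = φ (b * a)
  normal : ∀ (D : Set A) (x : A), D.Nonempty → DirectedOn (· ≤ ·) D → (∀ a ∈ D, 0 ≤ a) →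
    IsLUB D x → IsLUB ((fun a => (φ a).re) '' D) (φ x).re

end State

section Freeness

variable {A : Type*} [Ring A] [Algebra ℂ A]

/-- Freeness of a family of unital subalgebras: an alternating product of at least one centred
factor is centred. -/
def FreeSubalgebras {ι : Type*} (φ : A →ₗ[ℂ] ℂ) (B : ι → Subalgebra ℂ A) : Prop :=
  ∀ (n : ℕ) (j : Fin (n + 1) → ι) (a : Fin (n + 1) → A),
    (∀ i, a i ∈ B (j i)) → (∀ i, φ (a i) = 0) →
    (∀ i : Fin n, j i.castSucc ≠ j i.succ) →
    φ (List.ofFn a).prod = 0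

/-- Two random variables are free if the unital algebras they generate are free
(used for self-adjoint variables). -/
def Free (φ : A →ₗ[ℂ] ℂ) (X Y : A) : Prop :=
  FreeSubalgebras φ ![Algebra.adjoin ℂ {X}, Algebra.adjoin ℂ {Y}]

/-- `μ` is the distribution of the (self-adjoint) variable `X`: the compactly supported
probability measure on the line with the moments of `X`. -/
structure HasDistribution (φ : A →ₗ[ℂ] ℂ) (X : A) (μ : Measure ℝ) : Prop where
  isProbabilityMeasure : IsProbabilityMeasure μ
  compactSupport : ∃ K : Set ℝ, IsCompact K ∧ μ Kᶜ = 0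
  moments : ∀ n : ℕ, φ (X ^ n) = ((∫ t, t ^ n ∂μ : ℝ) : ℂ)

/-- The distribution of `X` is not a point mass. -/
def NonDegenerate (φ : A →ₗ[ℂ] ℂ) (X : A) : Prop :=
  ∀ r : ℝ, ¬ HasDistribution φ X (Measure.dirac r)

end Freeness

section ConditionalExpectation

variable {H : Type*} [NormedAddCommGroup H] [InnerProductSpace ℂ H] [CompleteSpace H]

/-- The von Neumann algebra generated by an operator `T` and the identity, that is, the double
commutant of `{T, T*}`. -/
def generatedBy (T : H →L[ℂ] H) : VonNeumannAlgebra H where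
  toStarSubalgebra :=
    StarSubalgebra.centralizer ℂ (StarSubalgebra.centralizer ℂ {T} : Set (H →L[ℂ] H))
  centralizer_centralizer' := by simp

/-- `E` is the `φ`-preserving conditional expectation of the von Neumann algebra `M` onto its
von Neumann subalgebra `N`: a positive `N`-bimodule projection of `M` onto `N` with `φ ∘ E = φ`.
For a faithful normal tracial state `φ` there is exactly one such map, and it is faithful
and normal. -/
structure IsCondExp {M : VonNeumannAlgebra H} (φ : M.toStarSubalgebra →ₗ[ℂ] ℂ)
    (N : VonNeumannAlgebra H) (E : M.toStarSubalgebra →ₗ[ℂ] M.toStarSubalgebra) : Prop where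
  le : N ≤ M
  mem : ∀ a, (E a : H →L[ℂ] H) ∈ N
  proj : ∀ b : M.toStarSubalgebra, (b : H →L[ℂ] H) ∈ N → E b = b
  nonneg : ∀ a, 0 ≤ a → 0 ≤ E a
  bimodule : ∀ b₁ a b₂ : M.toStarSubalgebra, (b₁ : H →L[ℂ] H) ∈ N → (b₂ : H →L[ℂ] H) ∈ N →
    E (b₁ * a * b₂) = b₁ * E a * b₂
  preserves : ∀ a, φ (E a) = φ a

end ConditionalExpectation

/-- The Marchenko–Pastur (free Poisson) distribution with the given rate and jump size: an atom
of mass `max(0, 1 - rate)` at `0` and an absolutely continuous part. -/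
def freePoisson (rate jump : ℝ) : Measure ℝ :=
  ENNReal.ofReal (max 0 (1 - rate)) • Measure.dirac 0 +
    (volume.restrict
      (Set.Ioo (jump * (1 - √rate) ^ 2) (jump * (1 + √rate) ^ 2))).withDensity
      fun x => ENNReal.ofReal
        (1 / (2 * Real.pi * jump * x) * √(4 * rate * jump ^ 2 - (x - jump * (1 + rate)) ^ 2))

/-- `μ` is the free generalized inverse Gaussian distribution with parameters `lam`, `α`, `β`. -/
def IsFreeGIG (μ : Measure ℝ) (lam α β : ℝ) : Prop :=
  0 < α ∧ 0 < β ∧ ∃ a b : ℝ, 0 < a ∧ a < b ∧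
    1 - lam + α * √(a * b) - β * ((a + b) / (2 * (a * b))) = 0 ∧
    1 + lam + β / √(a * b) - α * ((a + b) / 2) = 0 ∧
    μ = (volume.restrict (Set.Icc a b)).withDensity fun x => ENNReal.ofReal
      (1 / (2 * Real.pi) * √((x - a) * (b - x)) * (α / x + β / (√(a * b) * x ^ 2)))

end FreeMY

end

/-! Put S = X + Y and let G_X, G_Y be the Cauchy transforms. Freeness enters only through
subordination at large real points: if G_X(x) = G_Y(y) = g and z = x + y - 1/g, then (z - S)⁻¹ and
(x - X)⁻¹ have the same trace against every element of the closed algebra generated by X, and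
likewise for Y. With P and Q the centred resolvents (x - X)⁻¹/g - 1 and (y - Y)⁻¹/g - 1, one has (z
- S)⁻¹ = g(1 + Q)(1 - PQ)⁻¹(1 + P), and freeness annihilates everything in the Neumann series except
1 + P (`Free.isUnit_and_map_mul_resolvent`).

Since V⁻¹ = X Y⁻¹ S, testing the two regressions against R = (z - S)⁻¹ expresses φ(X⁻¹R) and φ(Y⁻¹R)
through φ(R), φ(S⁻¹R), φ(S⁻²R). Subordination turns the left sides into functions of (x, g) and (y,
g), and elimination leaves one quadratic equation for G_X and one for G_Y
(`ConstantRegressions.quadratics`). Near infinity the equation for G_Y rules out cd < 1, and for cd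
= 1 it forces a point mass (`ConstantRegressions.one_lt_mul`).

Both equations have the form x²G² - (αx² + lx - β)G + αx + k = 0. For Y all coefficients are
explicit. For X the constant k = βφ(X⁻¹) is unknown; it is controlled by analyticity of G_X off [0,
‖X‖] and its sign on the negative axis, which force the discriminant to be (αx + η)²(x - a)(x - b)
with 0 < a < b (`exists_roots_of_quadratic`). Comparing coefficients yields the free GIG equations
for a and b.

The density with these parameters has an explicit Cauchy transform solving the same quadratic
(`integral_gigDensity_div_sub`). The branches agree near infinity, so the moments agree
(`hasDistribution_of_quadratic`). -/

noncomputable section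

/-! ### Von Neumann algebras as ordered C*-algebras -/

namespace VonNeumannAlgebra

variable {H : Type*} [NormedAddCommGroup H] [InnerProductSpace ℂ H] [CompleteSpace H]

theorem mem_of_forall_commute (M : VonNeumannAlgebra H) {T : H →L[ℂ] H}
    (hT : ∀ R ∈ M.commutant, Commute T R) : T ∈ M.toStarSubalgebra := by
  change T ∈ M
  rw [← M.commutant_commutant, mem_commutant_iff]
  exact fun R hR => (hT R hR).symm.eq

theorem isClosed (M : VonNeumannAlgebra H) :
    IsClosed (M.toStarSubalgebra : Set (H →L[ℂ] H)) := by
  have h : (M.toStarSubalgebra : Set (H →L[ℂ] H)) =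
      Set.centralizer (M.commutant : Set (H →L[ℂ] H)) := by simp
  rw [h]
  exact Set.isClosed_centralizer _

theorem commute_of_mem_commutant {M : VonNeumannAlgebra H} (x : M.toStarSubalgebra)
    {R : H →L[ℂ] H} (hR : R ∈ M.commutant) : Commute (x : H →L[ℂ] H) R :=
  mem_commutant_iff.1 hR x x.2

/-- The order on M is inherited from the operators on H, so a positive element needs its square root
inside M. The root commutes with everything its square commutes with, hence lies in the double
commutant. -/
theorem starOrderedRing (M : VonNeumannAlgebra H) :
    StarOrderedRing M.toStarSubalgebra := by
  refine StarOrderedRing.of_nonneg_iff' ?_ ?_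
  · intro x y hxy z
    exact add_le_add_right (α := H →L[ℂ] H) hxy z.1
  · intro x
    constructor
    · intro hx
      have hx' : 0 ≤ (x : H →L[ℂ] H) := hx
      have hm : CFC.sqrt (x : H →L[ℂ] H) ∈ M.toStarSubalgebra :=
        M.mem_of_forall_commute fun R hR =>
          (commute_of_mem_commutant x hR).cfcₙ_nnreal NNReal.sqrt
      refine ⟨⟨_, hm⟩, Subtype.ext ?_⟩
      change (x : H →L[ℂ] H) = star (CFC.sqrt (x : H →L[ℂ] H)) * CFC.sqrt (x : H →L[ℂ] H)
      rw [(CFC.sqrt_nonneg _).isSelfAdjoint.star_eq, CFC.sqrt_mul_sqrt_self _ hx']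
    · rintro ⟨s, rfl⟩
      exact star_mul_self_nonneg (s : H →L[ℂ] H)

end VonNeumannAlgebra

attribute [local instance] VonNeumannAlgebra.isClosed VonNeumannAlgebra.starOrderedRing

namespace FreeMY

/-! ### Inequalities for the trace -/

section State

variable {A : Type*} [CStarAlgebra A] [PartialOrder A] {φ : A →ₗ[ℂ] ℂ}

theorem IsFaithfulNormalTracialState.map_algebraMap (hφ : IsFaithfulNormalTracialState φ)
    (z : ℂ) : φ (algebraMap ℂ A z) = z := by
  rw [Algebra.algebraMap_eq_smul_one, map_smul, hφ.map_one, smul_eq_mul, mul_one]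

theorem IsFaithfulNormalTracialState.map_algebraMap_real (hφ : IsFaithfulNormalTracialState φ)
    (r : ℝ) : φ (algebraMap ℝ A r) = r := by
  rw [IsScalarTower.algebraMap_apply ℝ ℂ A, hφ.map_algebraMap]; rfl

variable [StarOrderedRing A]

theorem IsFaithfulNormalTracialState.mono (hφ : IsFaithfulNormalTracialState φ) {a b : A}
    (h : a ≤ b) : φ a ≤ φ b := by
  simpa using hφ.nonneg (b - a) (sub_nonneg.2 h)

theorem IsFaithfulNormalTracialState.continuous (hφ : IsFaithfulNormalTracialState φ) :
    Continuous φ := by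
  obtain ⟨C, hC⟩ := (PositiveLinearMap.mk₀ φ hφ.nonneg).exists_norm_apply_le
  exact AddMonoidHomClass.continuous_of_bound φ C hC

theorem IsFaithfulNormalTracialState.eq_re_of_isSelfAdjoint
    (hφ : IsFaithfulNormalTracialState φ) {a : A} (ha : IsSelfAdjoint a) :
    φ a = ((φ a).re : ℂ) := by
  have h := hφ.mono ha.le_algebraMap_norm_self
  rw [hφ.map_algebraMap_real] at h
  have him := (Complex.le_def.1 h).2
  apply Complex.ext <;> simp_all

theorem IsFaithfulNormalTracialState.re_mono (hφ : IsFaithfulNormalTracialState φ) {a b : A}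
    (h : a ≤ b) : (φ a).re ≤ (φ b).re := (Complex.le_def.1 (hφ.mono h)).1

/-- Cauchy–Schwarz for a^{1/2} and a^{-1/2}, without roots: φ((1 - t a⁻¹) a (1 - t a⁻¹)) is a
nonnegative quadratic in t, so its discriminant is at most zero. -/
theorem IsFaithfulNormalTracialState.one_le_mul (hφ : IsFaithfulNormalTracialState φ) {a : A}
    (ha : IsStrictlyPositive a) : 1 ≤ (φ a).re * (φ (Ring.inverse a)).re := by
  have key : ∀ t : ℝ, 0 ≤ (φ (Ring.inverse a)).re * (t * t) + (-2) * t + (φ a).re := by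
    intro t
    have hb := ha.ringInverse
    have h1 : 0 ≤ star (1 - (t : ℂ) • Ring.inverse a) * a * (1 - (t : ℂ) • Ring.inverse a) :=
      star_left_conjugate_nonneg ha.nonneg _
    have h2 : star (1 - (t : ℂ) • Ring.inverse a) * a * (1 - (t : ℂ) • Ring.inverse a)
        = a - (2 * t : ℂ) • 1 + (t * t : ℂ) • Ring.inverse a := by
      have hs : star (Ring.inverse a) = Ring.inverse a := hb.nonneg.isSelfAdjoint.star_eq
      simp only [star_sub, star_one, star_smul, hs, sub_mul, mul_sub, one_mul, mul_one,
        smul_mul_assoc, mul_smul_comm, Ring.inverse_mul_cancel _ ha.isUnit,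
        Ring.mul_inverse_cancel _ ha.isUnit]
      simp only [RCLike.star_def, Complex.conj_ofReal]
      module
    rw [h2] at h1
    have h3 := (Complex.le_def.1 (hφ.nonneg _ h1)).1
    simp [hφ.map_one] at h3
    linarith
  have := discrim_le_zero key
  rw [discrim] at this
  nlinarith

theorem IsFaithfulNormalTracialState.re_pos (hφ : IsFaithfulNormalTracialState φ) {a : A}
    (ha : IsStrictlyPositive a) : 0 < (φ a).re := by
  have h0 : 0 ≤ (φ a).re := (Complex.le_def.1 (hφ.nonneg _ ha.nonneg)).1
  rcases h0.lt_or_eq with h | h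
  · exact h
  · have := hφ.one_le_mul ha
    rw [← h] at this
    norm_num at this

end State

/-! ### Inverses in the closed algebra of a self-adjoint element -/

section Closure

variable {A : Type*} [CStarAlgebra A]

/-- For self-adjoint a the closed algebra is a C*-algebra, so spectral permanence applies. It puts
resolvents and X⁻¹, Y⁻¹ within reach of freeness. -/
theorem inverse_mem_topologicalClosure_adjoin {a b : A} (ha : IsSelfAdjoint a)
    (hb : b ∈ (Algebra.adjoin ℂ {a}).topologicalClosure) (hu : IsUnit b) :
    Ring.inverse b ∈ (Algebra.adjoin ℂ {a}).topologicalClosure := by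
  have he : (StarAlgebra.elemental ℂ a).toSubalgebra =
      (Algebra.adjoin ℂ {a}).topologicalClosure := by
    change (StarAlgebra.adjoin ℂ {a}).toSubalgebra.topologicalClosure = _
    rw [StarAlgebra.adjoin_toSubalgebra, Set.star_singleton, ha.star_eq, Set.union_self]
  rw [← he] at hb ⊢
  have hcl : IsClosed (StarAlgebra.elemental ℂ a : Set A) := StarAlgebra.elemental.isClosed ℂ a
  obtain ⟨v, hv⟩ := (StarSubalgebra.coe_isUnit (S := StarAlgebra.elemental ℂ a)
    (a := ⟨b, hb⟩)).1 hu
  have hinv : Ring.inverse b = ((v⁻¹ : (StarAlgebra.elemental ℂ a)ˣ) : StarAlgebra.elemental ℂ a) := by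
    have h1 : (((v⁻¹ : (StarAlgebra.elemental ℂ a)ˣ) : StarAlgebra.elemental ℂ a) : A) * b = 1 := by
      have := congrArg (Subtype.val) v.inv_mul
      rw [hv] at this
      exact this
    calc Ring.inverse b = (((v⁻¹ : (StarAlgebra.elemental ℂ a)ˣ) : StarAlgebra.elemental ℂ a) : A)
          * b * Ring.inverse b := by rw [h1, one_mul]
      _ = _ := by rw [mul_assoc, Ring.mul_inverse_cancel _ hu, mul_one]
  rw [hinv]
  exact Subtype.property _

theorem algebraMap_sub_mem_topologicalClosure_adjoin (a : A) (z : ℂ) :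
    algebraMap ℂ A z - a ∈ (Algebra.adjoin ℂ {a}).topologicalClosure :=
  sub_mem (Subalgebra.algebraMap_mem _ _)
    (Subalgebra.le_topologicalClosure _ (Algebra.self_mem_adjoin_singleton ℂ a))

end Closure

/-! ### Freeness and alternating words -/

section Words

variable {A : Type*} [NormedRing A] [NormedAlgebra ℂ A] {ι : Type*}

/-- A centred limit of elements b is also the limit of the centred elements b - φ(b), so the
vanishing of centred alternating products passes to closures by continuity of φ. -/
theorem FreeSubalgebras.topologicalClosure {φ : A →ₗ[ℂ] ℂ} {B : ι → Subalgebra ℂ A}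
    (h : FreeSubalgebras φ B) (hφ : Continuous φ) (h1 : φ 1 = 1) :
    FreeSubalgebras φ fun i => (B i).topologicalClosure := by
  intro n j a ha hφa hj
  have hcent : ∀ i, a i ∈ closure {b | b ∈ B (j i) ∧ φ b = 0} := by
    intro i
    have hm : Set.MapsTo (fun b => b - φ b • (1 : A)) (B (j i)) {b | b ∈ B (j i) ∧ φ b = 0} := by
      intro b hb
      exact ⟨sub_mem hb (Subalgebra.smul_mem _ (one_mem _) _), by simp [h1]⟩
    have := map_mem_closure (f := fun b => b - φ b • (1 : A)) (by fun_prop)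
      (show a i ∈ closure (B (j i) : Set A) from ha i) hm
    simpa [hφa i] using this
  have hcl : IsClosed {a : Fin (n + 1) → A | φ (List.ofFn a).prod = 0} := by
    refine isClosed_eq (hφ.comp ?_) continuous_const
    simp only [List.ofFn_eq_map]
    exact continuous_list_prod _ fun i _ => continuous_apply i
  have hmem : a ∈ closure (Set.univ.pi fun i => {b | b ∈ B (j i) ∧ φ b = 0}) := by
    rw [closure_pi_set]
    exact fun i _ => hcent i
  refine (closure_minimal ?_ hcl) hmem
  intro b hb
  exact h n j b (fun i => (hb i trivial).1) (fun i => (hb i trivial).2) hj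

/-- An alternating product of centred elements of the algebras `B i`, beginning with a factor
from the algebra of the given index. -/
inductive IsAlternatingWord (φ : A →ₗ[ℂ] ℂ) (B : ι → Subalgebra ℂ A) : ι → A → Prop
  | single {i : ι} {a : A} (ha : a ∈ B i) (h0 : φ a = 0) : IsAlternatingWord φ B i a
  | cons {i k : ι} {a w : A} (ha : a ∈ B i) (h0 : φ a = 0) (hik : i ≠ k)
      (hw : IsAlternatingWord φ B k w) : IsAlternatingWord φ B i (a * w)

theorem IsAlternatingWord.exists_fin {φ : A →ₗ[ℂ] ℂ} {B : ι → Subalgebra ℂ A} {i : ι} {w : A}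
    (hw : IsAlternatingWord φ B i w) :
    ∃ (n : ℕ) (j : Fin (n + 1) → ι) (a : Fin (n + 1) → A), j 0 = i ∧
      (∀ i, a i ∈ B (j i)) ∧ (∀ i, φ (a i) = 0) ∧
      (∀ i : Fin n, j i.castSucc ≠ j i.succ) ∧ (List.ofFn a).prod = w := by
  induction hw with
  | @single i a ha h0 =>
    exact ⟨0, fun _ => i, fun _ => a, rfl, fun _ => ha, fun _ => h0, fun i => i.elim0, by simp⟩
  | @cons i k b w hb h0 hik _ ih =>
    obtain ⟨n, j, a, hj0, ha, hφa, hj, hprod⟩ := ih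
    refine ⟨n + 1, Fin.cons i j, Fin.cons b a, rfl, ?_, ?_, ?_, ?_⟩
    · intro m
      refine Fin.cases ?_ (fun m => ?_) m
      · simpa using hb
      · simpa using ha m
    · intro m
      refine Fin.cases ?_ (fun m => ?_) m
      · simpa using h0
      · simpa using hφa m
    · intro m
      refine Fin.cases ?_ (fun m => ?_) m
      · simpa [hj0] using hik
      · simpa using hj m
    · rw [List.ofFn_succ, List.prod_cons, Fin.cons_zero]
      simp only [Fin.cons_succ]
      rw [hprod]

theorem FreeSubalgebras.map_word {φ : A →ₗ[ℂ] ℂ} {B : ι → Subalgebra ℂ A}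
    (h : FreeSubalgebras φ B) {i : ι} {w : A} (hw : IsAlternatingWord φ B i w) : φ w = 0 := by
  obtain ⟨n, j, a, -, ha, h0, hj, rfl⟩ := hw.exists_fin
  exact h n j a ha h0 hj

theorem FreeSubalgebras.map_mul_word {φ : A →ₗ[ℂ] ℂ} {B : ι → Subalgebra ℂ A}
    (h : FreeSubalgebras φ B) (h1 : φ 1 = 1) {i k : ι} (hik : i ≠ k) {x w : A} (hx : x ∈ B i)
    (hw : IsAlternatingWord φ B k w) : φ (x * w) = 0 := by
  have h2 : φ ((x - φ x • (1 : A)) * w) = 0 :=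
    h.map_word (.cons (sub_mem hx (Subalgebra.smul_mem _ (one_mem _) _)) (by simp [h1]) hik hw)
  rw [sub_mul, map_sub, smul_mul_assoc, one_mul, map_smul, h.map_word hw] at h2
  simpa using h2

theorem isAlternatingWord_mul_pow {φ : A →ₗ[ℂ] ℂ} {B : ι → Subalgebra ℂ A} {i k : ι}
    (hik : i ≠ k) {P Q : A} (hP : P ∈ B i) (hQ : Q ∈ B k) (hP0 : φ P = 0) (hQ0 : φ Q = 0) (n : ℕ) :
    IsAlternatingWord φ B k (Q * (P * Q) ^ n) ∧ IsAlternatingWord φ B k (Q * (P * Q) ^ n * P) := by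
  induction n with
  | zero =>
    simp only [pow_zero, mul_one]
    exact ⟨.single hQ hQ0, .cons hQ hQ0 hik.symm (.single hP hP0)⟩
  | succ n ih =>
    constructor
    · have := IsAlternatingWord.cons hQ hQ0 hik.symm (.cons hP hP0 hik ih.1)
      rwa [show Q * (P * (Q * (P * Q) ^ n)) = Q * (P * Q) ^ (n + 1) by
        rw [pow_succ']; simp only [mul_assoc]] at this
    · have := IsAlternatingWord.cons hQ hQ0 hik.symm (.cons hP hP0 hik ih.2)
      rwa [show Q * (P * (Q * (P * Q) ^ n * P)) = Q * (P * Q) ^ (n + 1) * P by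
        rw [pow_succ']; simp only [mul_assoc]] at this

/-- In the Neumann series every summand has the form y·w with y = x or y = xP in the algebra `B i`
and w an alternating word starting with Q, except the summand x(1 + P) of order zero. Splitting y
into its mean and its centred part shows that φ(y·w) = 0. -/
theorem FreeSubalgebras.map_mul_inverse_one_sub [CompleteSpace A] {φ : A →ₗ[ℂ] ℂ}
    {B : ι → Subalgebra ℂ A} (h : FreeSubalgebras φ B) (hφ : Continuous φ) (h1 : φ 1 = 1)
    {i k : ι} (hik : i ≠ k) {P Q x : A} (hP : P ∈ B i) (hQ : Q ∈ B k) (hP0 : φ P = 0)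
    (hQ0 : φ Q = 0) (hx : x ∈ B i) (hPQ : ‖P * Q‖ < 1) :
    φ (x * ((1 + Q) * Ring.inverse (1 - P * Q) * (1 + P))) = φ (x * (1 + P)) := by
  have hs := hasSum_geom_series_inverse (P * Q) hPQ
  have hs2 : HasSum (fun n : ℕ => φ (x * ((1 + Q) * (P * Q) ^ n * (1 + P))))
      (φ (x * ((1 + Q) * Ring.inverse (1 - P * Q) * (1 + P)))) :=
    (((hs.mul_left (1 + Q)).mul_right (1 + P)).mul_left x).map φ hφ
  have hW : ∀ y ∈ B i, ∀ n : ℕ, φ (y * (Q * (P * Q) ^ n * (1 + P))) = 0 := by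
    intro y hy n
    obtain ⟨w1, w2⟩ := isAlternatingWord_mul_pow hik hP hQ hP0 hQ0 n
    rw [mul_add, mul_one, mul_add, map_add, h.map_mul_word h1 hik hy w1,
      h.map_mul_word h1 hik hy w2, add_zero]
  have hterm : ∀ n : ℕ, n ≠ 0 → φ (x * ((1 + Q) * (P * Q) ^ n * (1 + P))) = 0 := by
    intro n hn
    obtain ⟨m, rfl⟩ := Nat.exists_eq_succ_of_ne_zero hn
    have : x * ((1 + Q) * (P * Q) ^ (m + 1) * (1 + P)) =
        (x * P) * (Q * (P * Q) ^ m * (1 + P)) + x * (Q * (P * Q) ^ (m + 1) * (1 + P)) := by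
      rw [add_mul, add_mul, one_mul, mul_add]
      congr 1
      rw [pow_succ']; simp only [mul_assoc]
    rw [Nat.succ_eq_add_one, this, map_add, hW _ (mul_mem hx hP), hW _ hx, add_zero]
  have hs3 := hasSum_single 0 hterm
  rw [hs2.unique hs3]
  have h0 := hW x hx 0
  simp only [pow_zero, mul_one] at h0 ⊢
  rw [add_mul, one_mul, mul_add, map_add, h0, add_zero]

end Words

theorem inverse_eq_of_mul_eq_one {R : Type*} [MonoidWithZero R] {a b : R} (ha : IsUnit a)
    (h : a * b = 1) : Ring.inverse a = b := by
  rw [← mul_one (Ring.inverse a), ← h, Ring.inverse_mul_cancel_left _ _ ha]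

/-! ### Resolvents and Cauchy transforms at large real points -/

section Resolvent

variable {A : Type*} [CStarAlgebra A]

theorem algebraMap_ofReal (x : ℝ) : algebraMap ℂ A (x : ℂ) = algebraMap ℝ A x :=
  (IsScalarTower.algebraMap_apply ℝ ℂ A x).symm

theorem inverse_algebraMap_real {x : ℝ} (hx : x ≠ 0) :
    Ring.inverse (algebraMap ℝ A x) = algebraMap ℝ A x⁻¹ :=
  inverse_eq_of_mul_eq_one ((isUnit_iff_ne_zero.2 hx).map _)
    (by rw [← map_mul, mul_inv_cancel₀ hx, map_one])

theorem resolvent_ofReal (X : A) (x : ℝ) :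
    resolvent X (x : ℂ) = Ring.inverse (algebraMap ℝ A x - X) := by
  rw [resolvent, algebraMap_ofReal]

variable [PartialOrder A] [StarOrderedRing A]

theorem isStrictlyPositive_algebraMap_sub {X : A} (hX : IsSelfAdjoint X) {x : ℝ}
    (hx : ‖X‖ < x) : IsStrictlyPositive (algebraMap ℝ A x - X) := by
  refine (isStrictlyPositive_algebraMap (A := A) (sub_pos.2 hx)).of_le ?_
  rw [map_sub]
  exact sub_le_sub_left hX.le_algebraMap_norm_self _

theorem algebraMap_inv_le_resolvent {X : A} (hX : 0 ≤ X) {x : ℝ} (hx : ‖X‖ < x) :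
    algebraMap ℝ A x⁻¹ ≤ resolvent X (x : ℂ) := by
  have hx0 : 0 < x := (norm_nonneg X).trans_lt hx
  rw [resolvent_ofReal, ← inverse_algebraMap_real hx0.ne']
  exact CStarAlgebra.ringInverse_le_ringInverse (sub_le_self _ hX)
    (isStrictlyPositive_algebraMap_sub hX.isSelfAdjoint hx)

theorem resolvent_le_algebraMap_inv {X : A} (hX : 0 ≤ X) {x : ℝ} (hx : ‖X‖ < x) :
    resolvent X (x : ℂ) ≤ algebraMap ℝ A (x - ‖X‖)⁻¹ := by
  have hx0 : 0 < x - ‖X‖ := sub_pos.2 hx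
  rw [resolvent_ofReal, ← inverse_algebraMap_real hx0.ne']
  refine CStarAlgebra.ringInverse_le_ringInverse ?_ (isStrictlyPositive_algebraMap hx0)
  rw [map_sub]
  exact sub_le_sub_left hX.isSelfAdjoint.le_algebraMap_norm_self _

theorem isStrictlyPositive_algebraMap_add {X : A} (hX : 0 ≤ X) {x : ℝ} (hx : 0 < x) :
    IsStrictlyPositive (algebraMap ℝ A x + X) :=
  (isStrictlyPositive_algebraMap hx).add_nonneg hX

theorem mem_resolventSet_of_norm_lt {X : A} (hX : IsSelfAdjoint X) {x : ℝ} (hx : ‖X‖ < x) :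
    (x : ℂ) ∈ resolventSet ℂ X := by
  rw [spectrum.mem_resolventSet_iff, algebraMap_ofReal]
  exact (isStrictlyPositive_algebraMap_sub hX hx).isUnit

variable {φ : A →ₗ[ℂ] ℂ}

/-- The Cauchy transform of a variable at a real point. -/
def cauchyTransform (φ : A →ₗ[ℂ] ℂ) (X : A) (x : ℝ) : ℝ := (φ (resolvent X (x : ℂ))).re

theorem map_resolvent_ofReal (hφ : IsFaithfulNormalTracialState φ) {X : A}
    (hX : IsSelfAdjoint X) (x : ℝ) : φ (resolvent X (x : ℂ)) = cauchyTransform φ X x := by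
  refine hφ.eq_re_of_isSelfAdjoint ?_
  rw [resolvent_ofReal]
  have h : IsSelfAdjoint (algebraMap ℝ A x - X) := (IsSelfAdjoint.algebraMap A (by rfl)).sub hX
  rw [IsSelfAdjoint, ← Ring.inverse_star, h.star_eq]

theorem inv_le_cauchyTransform (hφ : IsFaithfulNormalTracialState φ) {X : A} (hX : 0 ≤ X)
    {x : ℝ} (hx : ‖X‖ < x) : x⁻¹ ≤ cauchyTransform φ X x := by
  have := hφ.re_mono (algebraMap_inv_le_resolvent hX hx)
  rwa [hφ.map_algebraMap_real, Complex.ofReal_re] at this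

theorem cauchyTransform_le_inv (hφ : IsFaithfulNormalTracialState φ) {X : A} (hX : 0 ≤ X)
    {x : ℝ} (hx : ‖X‖ < x) : cauchyTransform φ X x ≤ (x - ‖X‖)⁻¹ := by
  have := hφ.re_mono (resolvent_le_algebraMap_inv hX hx)
  rwa [hφ.map_algebraMap_real, Complex.ofReal_re] at this

theorem continuousAt_cauchyTransform (hφ : IsFaithfulNormalTracialState φ) {X : A} {x : ℝ}
    (hx : (x : ℂ) ∈ resolventSet ℂ X) : ContinuousAt (cauchyTransform φ X) x := by
  have h1 : ContinuousAt (fun t : ℝ => resolvent X (t : ℂ)) x :=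
    ContinuousAt.comp (f := fun t : ℝ => (t : ℂ)) (g := fun z : ℂ => resolvent X z)
      (spectrum.hasDerivAt_resolvent_const_left hx).continuousAt
      Complex.continuous_ofReal.continuousAt
  exact Complex.continuous_re.continuousAt.comp (hφ.continuous.continuousAt.comp h1)

/-- The bounds 1/x ≤ G(x) ≤ 1/(x - ‖X‖) give G ≥ g at 1/g and G ≤ g at 1/g + ‖X‖; the intermediate
value theorem does the rest. -/
theorem exists_cauchyTransform_eq (hφ : IsFaithfulNormalTracialState φ) {X : A} (hX : 0 ≤ X)
    {g : ℝ} (hg : 0 < g) (hgX : g * ‖X‖ < 1) : ∃ x, ‖X‖ < x ∧ cauchyTransform φ X x = g := by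
  have h0 : ‖X‖ < g⁻¹ := by
    rw [← one_div, lt_div_iff₀ hg]; linarith
  have hle : g⁻¹ ≤ g⁻¹ + ‖X‖ := le_add_of_nonneg_right (norm_nonneg X)
  have hc : ContinuousOn (cauchyTransform φ X) (Set.Icc g⁻¹ (g⁻¹ + ‖X‖)) := fun t ht =>
    (continuousAt_cauchyTransform hφ
      (mem_resolventSet_of_norm_lt hX.isSelfAdjoint (h0.trans_le ht.1))).continuousWithinAt
  have h1 := inv_le_cauchyTransform hφ hX h0
  have h2 := cauchyTransform_le_inv hφ hX (h0.trans_le hle)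
  rw [inv_inv] at h1
  rw [add_sub_cancel_right, inv_inv] at h2
  obtain ⟨x, hx, hxg⟩ := intermediate_value_Icc' hle hc ⟨h2, h1⟩
  exact ⟨x, h0.trans_le hx.1, hxg⟩

theorem norm_inv_smul_resolvent_sub_one (hφ : IsFaithfulNormalTracialState φ) {X : A}
    (hX : 0 ≤ X) {x g : ℝ} (hx : ‖X‖ < x) (hg : cauchyTransform φ X x = g)
    (hgX : g * ‖X‖ ≤ 1 / 4) : ‖(g : ℂ)⁻¹ • resolvent X (x : ℂ) - 1‖ < 1 := by
  have hx0 : 0 < x := (norm_nonneg X).trans_lt hx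
  have h1 := inv_le_cauchyTransform hφ hX hx
  have h2 := cauchyTransform_le_inv hφ hX hx
  have hg0 : 0 < g := hg ▸ (inv_pos.2 hx0).trans_le h1
  rw [hg] at h1 h2
  have h1' : 1 ≤ g * x := by rwa [inv_le_iff_one_le_mul₀ hx0] at h1
  have h2' : g * (x - ‖X‖) ≤ 1 := by
    rwa [← one_div, le_div_iff₀ (sub_pos.2 hx)] at h2
  have : Nontrivial A := ⟨1, 0, fun h => by simpa [h] using hφ.map_one⟩
  set D := resolvent X (x : ℂ) - algebraMap ℝ A x⁻¹ with hD
  have hD1 : ‖D‖ ≤ (x - ‖X‖)⁻¹ - x⁻¹ := by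
    rw [CStarAlgebra.norm_le_iff_le_algebraMap D (sub_nonneg.2 (h1.trans h2))
      (sub_nonneg.2 (algebraMap_inv_le_resolvent hX hx)), map_sub]
    exact sub_le_sub_right (resolvent_le_algebraMap_inv hX hx) _
  have hP : (g : ℂ)⁻¹ • resolvent X (x : ℂ) - 1 = g⁻¹ • D + algebraMap ℝ A (g⁻¹ * x⁻¹ - 1) := by
    rw [hD, smul_sub, map_sub, map_one, ← Complex.ofReal_inv, Complex.coe_smul, map_mul,
      ← Algebra.smul_def]
    abel
  -- From 1 ≤ gx ≤ 1 + g‖X‖ ≤ 5/4 and g(x - ‖X‖) ≥ 3/4 the norm is at most 4/3 + 1 - 2·(4/5) =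
  -- 11/15.
  have e1 : g⁻¹ * (x - ‖X‖)⁻¹ ≤ 4 / 3 := by
    rw [← mul_inv, inv_le_comm₀ (mul_pos hg0 (sub_pos.2 hx)) (by norm_num)]
    linarith
  have e2 : 4 / 5 ≤ g⁻¹ * x⁻¹ := by
    rw [← mul_inv, le_inv_comm₀ (by norm_num) (mul_pos hg0 hx0)]
    linarith
  have e3 : g⁻¹ * x⁻¹ ≤ 1 := by
    rw [← mul_inv]; exact inv_le_one_of_one_le₀ h1'
  calc ‖(g : ℂ)⁻¹ • resolvent X (x : ℂ) - 1‖
      ≤ ‖g⁻¹ • D‖ + ‖algebraMap ℝ A (g⁻¹ * x⁻¹ - 1)‖ := by rw [hP]; exact norm_add_le _ _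
    _ ≤ g⁻¹ * ((x - ‖X‖)⁻¹ - x⁻¹) + (1 - g⁻¹ * x⁻¹) := by
      refine add_le_add ?_ ?_
      · rw [norm_smul, Real.norm_of_nonneg (inv_nonneg.2 hg0.le)]
        exact mul_le_mul_of_nonneg_left hD1 (inv_nonneg.2 hg0.le)
      · rw [norm_algebraMap', Real.norm_eq_abs, abs_of_nonpos (by linarith)]
        linarith
    _ < 1 := by rw [mul_sub]; linarith

end Resolvent

/-! ### Subordination of the resolvent of a free sum -/

section Subordination

variable {A : Type*} [NormedRing A] [NormedAlgebra ℂ A] [CompleteSpace A] {ι : Type*}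

/-- Here a and b play the resolvents of the summands and T plays z - S. With a = g(1 + P) and b =
g(1 + Q), the relation `hT` reads aTb = g(1 - PQ), so T⁻¹ = g(1 + Q)(1 - PQ)⁻¹(1 + P) and the word
computation applies. -/
theorem FreeSubalgebras.map_mul_inverse {φ : A →ₗ[ℂ] ℂ}
    {B : ι → Subalgebra ℂ A} (h : FreeSubalgebras φ B) (hφ : Continuous φ) (h1 : φ 1 = 1)
    {i k : ι} (hik : i ≠ k) {a b T : A} (ha : a ∈ B i) (hb : b ∈ B k) (hua : IsUnit a)
    (hub : IsUnit b) {g : ℂ} (hg : g ≠ 0) (hga : φ a = g) (hgb : φ b = g)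
    (hlt : ‖(g⁻¹ • a - 1) * (g⁻¹ • b - 1)‖ < 1) (hT : a * T * b = a + b - g⁻¹ • (a * b)) :
    IsUnit T ∧ ∀ x ∈ B i, φ (x * Ring.inverse T) = φ (x * a) := by
  set P := g⁻¹ • a - 1 with hP
  set Q := g⁻¹ • b - 1 with hQ
  have haP : a = g • (1 + P) := by simp [hP, smul_smul, hg]
  have hbQ : b = g • (1 + Q) := by simp [hQ, smul_smul, hg]
  have hu : IsUnit (1 - P * Q) := isUnit_one_sub_of_norm_lt_one hlt
  have hTPQ : a * T * b = g • (1 - P * Q) := by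
    rw [hT, haP, hbQ]
    simp only [mul_add, add_mul, smul_mul_assoc, mul_smul_comm, smul_smul, mul_one, one_mul,
      inv_mul_cancel_left₀ hg, smul_add, smul_sub]
    abel
  have hTu : IsUnit T := by
    have h2 : IsUnit (a * T * b) := by
      rw [hTPQ]
      rw [Algebra.smul_def]
      exact ((isUnit_iff_ne_zero.2 hg).map (algebraMap ℂ A)).mul hu
    obtain ⟨a, rfl⟩ := hua
    obtain ⟨b, rfl⟩ := hub
    rwa [Units.isUnit_mul_units, Units.isUnit_units_mul] at h2
  refine ⟨hTu, fun x hx => ?_⟩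
  have hinv : Ring.inverse T = b * Ring.inverse (1 - P * Q) * (g⁻¹ • a) := by
    refine inverse_eq_of_mul_eq_one hTu (hua.mul_left_cancel ?_)
    calc a * (T * (b * Ring.inverse (1 - P * Q) * (g⁻¹ • a)))
        = (a * T * b) * Ring.inverse (1 - P * Q) * (g⁻¹ • a) := by simp only [mul_assoc]
      _ = a * 1 := by
        rw [hTPQ, smul_mul_assoc, Ring.mul_inverse_cancel _ hu, smul_mul_smul_comm,
          mul_inv_cancel₀ hg, one_smul, one_mul, mul_one]
  have hP0 : φ P = 0 := by simp [hP, hga, h1, hg]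
  have hQ0 : φ Q = 0 := by simp [hQ, hgb, h1, hg]
  have hPm : P ∈ B i := sub_mem (Subalgebra.smul_mem _ ha _) (one_mem _)
  have hQm : Q ∈ B k := sub_mem (Subalgebra.smul_mem _ hb _) (one_mem _)
  have := h.map_mul_inverse_one_sub hφ h1 hik hPm hQm hP0 hQ0 hx hlt
  rw [hinv, hbQ, haP, smul_smul, inv_mul_cancel₀ hg, one_smul, smul_mul_assoc, smul_mul_assoc,
    mul_smul_comm, map_smul, this, mul_smul_comm, map_smul]

end Subordination

section FreePair

variable {A : Type*} [CStarAlgebra A] [PartialOrder A] [StarOrderedRing A] {φ : A →ₗ[ℂ] ℂ}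

theorem Free.isUnit_and_map_mul_resolvent (hφ : IsFaithfulNormalTracialState φ) {X Y : A}
    (hX : 0 ≤ X) (hY : 0 ≤ Y) (hfree : Free φ X Y) {x y g : ℝ} (hx : ‖X‖ < x) (hy : ‖Y‖ < y)
    (hg : 0 < g) (hgx : cauchyTransform φ X x = g) (hgy : cauchyTransform φ Y y = g)
    (hgX : g * ‖X‖ ≤ 1 / 4) (hgY : g * ‖Y‖ ≤ 1 / 4) {z : ℝ} (hz : z = x + y - g⁻¹) :
    IsUnit (algebraMap ℂ A z - (X + Y)) ∧
    (∀ h ∈ (Algebra.adjoin ℂ {X}).topologicalClosure,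
      φ (h * resolvent (X + Y) (z : ℂ)) = φ (h * resolvent X (x : ℂ))) ∧
    (∀ h ∈ (Algebra.adjoin ℂ {Y}).topologicalClosure,
      φ (h * resolvent (X + Y) (z : ℂ)) = φ (h * resolvent Y (y : ℂ))) := by
  have hF := FreeSubalgebras.topologicalClosure hfree hφ.continuous hφ.map_one
  have hux : IsUnit (algebraMap ℂ A (x : ℂ) - X) :=
    spectrum.mem_resolventSet_iff.1 (mem_resolventSet_of_norm_lt hX.isSelfAdjoint hx)
  have huy : IsUnit (algebraMap ℂ A (y : ℂ) - Y) :=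
    spectrum.mem_resolventSet_iff.1 (mem_resolventSet_of_norm_lt hY.isSelfAdjoint hy)
  set a := resolvent X (x : ℂ) with ha
  set b := resolvent Y (y : ℂ) with hb
  have hgC : (g : ℂ) ≠ 0 := by exact_mod_cast hg.ne'
  have hφa : φ a = g := by rw [ha, map_resolvent_ofReal hφ hX.isSelfAdjoint, hgx]
  have hφb : φ b = g := by rw [hb, map_resolvent_ofReal hφ hY.isSelfAdjoint, hgy]
  have hma : a ∈ (Algebra.adjoin ℂ {X}).topologicalClosure :=
    inverse_mem_topologicalClosure_adjoin hX.isSelfAdjoint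
      (algebraMap_sub_mem_topologicalClosure_adjoin X _) hux
  have hmb : b ∈ (Algebra.adjoin ℂ {Y}).topologicalClosure :=
    inverse_mem_topologicalClosure_adjoin hY.isSelfAdjoint
      (algebraMap_sub_mem_topologicalClosure_adjoin Y _) huy
  have hua : IsUnit a := hux.ringInverse
  have hub : IsUnit b := huy.ringInverse
  have na := norm_inv_smul_resolvent_sub_one hφ hX hx hgx hgX
  have nb := norm_inv_smul_resolvent_sub_one hφ hY hy hgy hgY
  have hab : ‖((g : ℂ)⁻¹ • a - 1) * ((g : ℂ)⁻¹ • b - 1)‖ < 1 :=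
    (norm_mul_le _ _).trans_lt (mul_lt_one_of_nonneg_of_lt_one_left (norm_nonneg _) na nb.le)
  have hba : ‖((g : ℂ)⁻¹ • b - 1) * ((g : ℂ)⁻¹ • a - 1)‖ < 1 :=
    (norm_mul_le _ _).trans_lt (mul_lt_one_of_nonneg_of_lt_one_left (norm_nonneg _) nb na.le)
  have hT : algebraMap ℂ A z - (X + Y) = (algebraMap ℂ A (x : ℂ) - X) +
      (algebraMap ℂ A (y : ℂ) - Y) - (g : ℂ)⁻¹ • (1 : A) := by
    rw [hz, ← Algebra.algebraMap_eq_smul_one]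
    rw [Complex.ofReal_sub, Complex.ofReal_add, Complex.ofReal_inv, map_sub, map_add]
    abel
  have hax : a * (algebraMap ℂ A (x : ℂ) - X) = 1 := Ring.inverse_mul_cancel _ hux
  have hxa : (algebraMap ℂ A (x : ℂ) - X) * a = 1 := Ring.mul_inverse_cancel _ hux
  have hby : b * (algebraMap ℂ A (y : ℂ) - Y) = 1 := Ring.inverse_mul_cancel _ huy
  have hyb : (algebraMap ℂ A (y : ℂ) - Y) * b = 1 := Ring.mul_inverse_cancel _ huy
  have h1 := hF.map_mul_inverse (i := 0) (k := 1) hφ.continuous hφ.map_one (by decide)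
    (T := algebraMap ℂ A z - (X + Y)) hma hmb hua hub hgC hφa hφb hab (by
      rw [hT]
      simp only [mul_sub, sub_mul, mul_add, add_mul]
      simp only [← mul_sub, ← sub_mul]
      rw [hax, mul_assoc a _ b, hyb, mul_smul_comm, mul_one, smul_mul_assoc, one_mul]
      abel)
  have h2 := hF.map_mul_inverse (i := 1) (k := 0) hφ.continuous hφ.map_one (by decide)
    (T := algebraMap ℂ A z - (X + Y)) hmb hma hub hua hgC hφb hφa hba (by
      rw [hT]
      simp only [mul_sub, sub_mul, mul_add, add_mul]
      simp only [← mul_sub, ← sub_mul]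
      rw [hby, mul_assoc b _ a, hxa, mul_smul_comm, mul_one, smul_mul_assoc, one_mul])
  exact ⟨h1.1, h1.2, h2.2⟩

end FreePair

/-! ### From constant regressions to quadratic equations -/

/-- The elimination step. The letters stand for traces: σ, σ₂ of S⁻¹, S⁻²; k, k₂ of S⁻¹R, S⁻²R; χ, δ
of X⁻¹, Y⁻¹, where R = (z - S)⁻¹. -/
theorem quadratic_of_subordination {x y g z c d σ σ₂ χ δ k k₂ : ℝ} (hz : z = x + y - g⁻¹)
    (hk : z * k = σ + g) (hk₂ : z * k₂ = σ₂ + k) (hx : x * (c * g + k) = χ + g)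
    (hy : y * (k + d * k₂) = δ + g) (hχ : χ = c + σ) (hδ : δ = σ + d * σ₂)
    (hg0 : 0 < g) (hz0 : 0 < z) (hσ0 : 0 < σ) (hδ0 : 0 < δ) :
    y * g * (δ - (c * d - 1) * g) = δ + g ∧
    x ^ 2 * g * (δ - (c * d - 1) * g) + x * ((1 + 2 * (c * d - 1)) * g - δ) - d * χ - d * g = 0 := by
  have hzg : z * g = x * g + y * g - 1 := by rw [hz]; field_simp
  have hA : x * (c * z * g + σ + g) = (χ + g) * z := by linear_combination z * hx - x * hk
  have hB : y * (z * (δ + g) + d * (σ + g)) = (δ + g) * z ^ 2 := by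
    linear_combination z ^ 2 * hy - y * (z + d) * hk - y * d * z * hk₂ + y * z * hδ
  -- Substituting x and y from `hA` and `hB` into zg = xg + yg - 1 and clearing denominators leaves
  -- a common factor σ + g, which is positive.
  have hS : z * (δ + g) + d * (σ + g) = z ^ 2 * g * (δ - (c * d - 1) * g) := by
    have h : (σ + g) * (z * (δ + g) + d * (σ + g) - z ^ 2 * g * (δ - (c * d - 1) * g)) = 0 := by
      subst hχ
      linear_combination ((c * z * g + σ + g) * (z * (δ + g) + d * (σ + g))) * hzg
        + g * (z * (δ + g) + d * (σ + g)) * hA + g * (c * z * g + σ + g) * hB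
    rcases mul_eq_zero.1 h with h | h
    · linarith
    · linarith
  have hY : y * g * (δ - (c * d - 1) * g) = δ + g := by
    rw [hS] at hB
    have hz2 : z ^ 2 ≠ 0 := by positivity
    exact mul_left_cancel₀ hz2 (by linear_combination hB)
  refine ⟨hY, ?_⟩
  set D := δ - (c * d - 1) * g with hD
  have hD0 : D ≠ 0 := by
    rintro h
    rw [h] at hY
    linarith
  -- This removes z: inserting it into `hS` leaves the equation in x and g alone.
  have hzD : z * D = x * D + c * d := by
    refine mul_left_cancel₀ hg0.ne' ?_
    linear_combination D * hzg + hY - hD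
  refine mul_left_cancel₀ hD0 ?_
  linear_combination -D * hS - ((z * D + x * D + c * d) * g - (δ + g)) * hzD
    - c * d * hD - d * D * hχ

theorem commute_inverse_right {R : Type*} [MonoidWithZero R] {a b : R} (h : Commute a b)
    (hb : IsUnit b) : Commute a (Ring.inverse b) := by
  obtain ⟨u, rfl⟩ := hb
  rw [Ring.inverse_unit]
  exact h.units_inv_right

section Regression

variable {A : Type*} [CStarAlgebra A] {φ : A →ₗ[ℂ] ℂ}

/-- The constant regressions of `V = X⁻¹ - (X + Y)⁻¹` and `V⁻¹` tested against a subalgebra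
containing `X + Y`. -/
structure ConstantRegressions (φ : A →ₗ[ℂ] ℂ) (X Y : A) (N : Subalgebra ℂ A) (c d : ℝ) :
    Prop where
  add_mem : X + Y ∈ N
  inverse_mem : ∀ a ∈ N, IsUnit a → Ring.inverse a ∈ N
  map_mul : ∀ T ∈ N, φ ((Ring.inverse X - Ring.inverse (X + Y)) * T) = c * φ T
  map_inverse_mul : ∀ T ∈ N,
    φ (Ring.inverse (Ring.inverse X - Ring.inverse (X + Y)) * T) = d * φ T

variable {X Y : A} {N : Subalgebra ℂ A} {c d : ℝ}

theorem ConstantRegressions.map_inverse_left_mul (h : ConstantRegressions φ X Y N c d) {T : A}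
    (hT : T ∈ N) : φ (Ring.inverse X * T) = c * φ T + φ (Ring.inverse (X + Y) * T) := by
  have := h.map_mul T hT
  rw [sub_mul, map_sub] at this
  linear_combination this

variable [PartialOrder A] [StarOrderedRing A]

theorem inverse_inverse_sub_inverse_add (hX : IsStrictlyPositive X)
    (hY : IsStrictlyPositive Y) :
    Ring.inverse (Ring.inverse X - Ring.inverse (X + Y)) = X * Ring.inverse Y * (X + Y) := by
  have hS := (hX.add_nonneg hY.nonneg).isUnit
  have e : Ring.inverse X - Ring.inverse (X + Y) = Ring.inverse (X + Y) * Y * Ring.inverse X := by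
    have h1 : Ring.inverse X = Ring.inverse (X + Y) * (X + Y) * Ring.inverse X := by
      rw [Ring.inverse_mul_cancel _ hS, one_mul]
    conv_lhs => rw [h1]
    rw [mul_add, add_mul, mul_assoc _ X, Ring.mul_inverse_cancel _ hX.isUnit, mul_one]
    abel
  rw [e]
  refine inverse_eq_of_mul_eq_one ((hS.ringInverse.mul hY.isUnit).mul hX.isUnit.ringInverse) ?_
  calc Ring.inverse (X + Y) * Y * Ring.inverse X * (X * Ring.inverse Y * (X + Y))
      = Ring.inverse (X + Y) * (Y * (Ring.inverse X * X) * Ring.inverse Y) * (X + Y) := by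
        simp only [mul_assoc]
    _ = 1 := by
      rw [Ring.inverse_mul_cancel _ hX.isUnit, mul_one, Ring.mul_inverse_cancel _ hY.isUnit,
        mul_one, Ring.inverse_mul_cancel _ hS]

/-- The regression of V⁻¹ = X Y⁻¹ S is tested against S⁻²T. Writing X = S - Y gives V⁻¹S⁻²T = S
Y⁻¹S⁻¹T - S⁻¹T, and traciality together with ST = TS cancels S. -/
theorem ConstantRegressions.map_inverse_right_mul (h : ConstantRegressions φ X Y N c d)
    (hφ : IsFaithfulNormalTracialState φ) (hX : IsStrictlyPositive X) (hY : IsStrictlyPositive Y)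
    {T : A} (hT : T ∈ N) (hcomm : Commute (X + Y) T) :
    φ (Ring.inverse Y * T) = φ (Ring.inverse (X + Y) * T)
      + d * φ (Ring.inverse (X + Y) * (Ring.inverse (X + Y) * T)) := by
  have hS := (hX.add_nonneg hY.nonneg).isUnit
  have hSm := h.inverse_mem _ h.add_mem hS
  have := h.map_inverse_mul _ (mul_mem hSm (mul_mem hSm hT))
  rw [← this, inverse_inverse_sub_inverse_add hX hY]
  have e1 : X * Ring.inverse Y * (X + Y) * (Ring.inverse (X + Y) * (Ring.inverse (X + Y) * T))
      = (X + Y) * (Ring.inverse Y * (Ring.inverse (X + Y) * T)) - Ring.inverse (X + Y) * T := by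
    rw [mul_assoc, Ring.mul_inverse_cancel_left _ _ hS, add_mul, ← mul_assoc Y,
      Ring.mul_inverse_cancel _ hY.isUnit, one_mul, mul_assoc, add_sub_cancel_right]
  have e2 : (Ring.inverse Y * (Ring.inverse (X + Y) * T)) * (X + Y) = Ring.inverse Y * T := by
    rw [mul_assoc, mul_assoc, ← hcomm.eq, Ring.inverse_mul_cancel_left _ _ hS]
  rw [e1, map_sub, hφ.tracial (X + Y), e2]
  ring

theorem ConstantRegressions.quadratics (h : ConstantRegressions φ X Y N c d)
    (hφ : IsFaithfulNormalTracialState φ) (hX : IsStrictlyPositive X) (hY : IsStrictlyPositive Y)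
    (hfree : Free φ X Y) {x y g : ℝ} (hx : ‖X‖ < x) (hy : ‖Y‖ < y)
    (hgx : cauchyTransform φ X x = g) (hgy : cauchyTransform φ Y y = g)
    (hgX : g * ‖X‖ ≤ 1 / 4) (hgY : g * ‖Y‖ ≤ 1 / 4) {χ δ : ℝ}
    (hχ : χ = (φ (Ring.inverse X)).re) (hδ : δ = (φ (Ring.inverse Y)).re) :
    y * g * (δ - (c * d - 1) * g) = δ + g ∧
    x ^ 2 * g * (δ - (c * d - 1) * g) + x * ((1 + 2 * (c * d - 1)) * g - δ) - d * χ - d * g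
      = 0 := by
  have hx0 : 0 < x := (norm_nonneg X).trans_lt hx
  have hy0 : 0 < y := (norm_nonneg Y).trans_lt hy
  have hxg := inv_le_cauchyTransform hφ hX.nonneg hx
  rw [hgx] at hxg
  have hg0 : 0 < g := (inv_pos.2 hx0).trans_le hxg
  set z := x + y - g⁻¹ with hz
  have hz0 : 0 < z := by
    have := (inv_le_comm₀ hx0 hg0).1 hxg
    linarith
  obtain ⟨hu, hRX, hRY⟩ := hfree.isUnit_and_map_mul_resolvent hφ hX.nonneg hY.nonneg hx hy hg0 hgx
    hgy hgX hgY hz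
  have hSp := hX.add_nonneg hY.nonneg
  set S := X + Y with hSdef
  set R := resolvent S (z : ℂ) with hR
  have hRm : R ∈ N := h.inverse_mem _ (sub_mem (Subalgebra.algebraMap_mem _ _) h.add_mem) hu
  have hSm := h.inverse_mem _ h.add_mem hSp.isUnit
  have hzR : (z : ℂ) • R = 1 + S * R := by
    have : (algebraMap ℂ A z - S) * R = 1 := Ring.mul_inverse_cancel _ hu
    rw [sub_mul, ← Algebra.smul_def] at this
    rw [← this]; abel
  have hSR : Commute S R := by
    have h1 : Commute (algebraMap ℂ A (z : ℂ)) S := Algebra.commutes (z : ℂ) S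
    exact commute_inverse_right (h1.symm.sub_right (Commute.refl S)) hu
  have hinvSelf : ∀ {a : A}, IsStrictlyPositive a →
      φ (Ring.inverse a) = ((φ (Ring.inverse a)).re : ℂ) := fun ha =>
    hφ.eq_re_of_isSelfAdjoint ha.ringInverse.isSelfAdjoint
  set σ := (φ (Ring.inverse S)).re with hσ
  have hσC : φ (Ring.inverse S) = (σ : ℂ) := hinvSelf hSp
  have hχC : φ (Ring.inverse X) = (χ : ℂ) := by rw [hχ]; exact hinvSelf hX
  have hδC : φ (Ring.inverse Y) = (δ : ℂ) := by rw [hδ]; exact hinvSelf hY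
  have hS2 : IsSelfAdjoint (Ring.inverse S * Ring.inverse S) := by
    have := hSp.ringInverse.isSelfAdjoint
    rw [IsSelfAdjoint, star_mul, this.star_eq]
  set σ₂ := (φ (Ring.inverse S * Ring.inverse S)).re with hσ₂
  have hσ₂C : φ (Ring.inverse S * Ring.inverse S) = (σ₂ : ℂ) := hφ.eq_re_of_isSelfAdjoint hS2
  have hφR : φ R = (g : ℂ) := by
    have := hRX 1 (one_mem _)
    rw [one_mul, one_mul, map_resolvent_ofReal hφ hX.isSelfAdjoint, hgx] at this
    exact this
  have hz1 : (z : ℂ) * φ (Ring.inverse S * R) = σ + g := by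
    rw [← smul_eq_mul, ← map_smul, ← mul_smul_comm, hzR, mul_add, mul_one,
      Ring.inverse_mul_cancel_left _ _ hSp.isUnit, map_add, hσC, hφR]
  have hz2 : (z : ℂ) * φ (Ring.inverse S * (Ring.inverse S * R)) = σ₂ + φ (Ring.inverse S * R) := by
    rw [← smul_eq_mul, ← map_smul, ← mul_smul_comm, ← mul_smul_comm, hzR, mul_add, mul_one,
      Ring.inverse_mul_cancel_left _ _ hSp.isUnit, mul_add, map_add, hσ₂C]
  have resX : ∀ {X : A} {x : ℝ}, IsStrictlyPositive X → ‖X‖ < x →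
      (x : ℂ) * φ (Ring.inverse X * resolvent X (x : ℂ))
        = φ (Ring.inverse X) + φ (resolvent X (x : ℂ)) := by
    intro X x hX hx
    have h1 : (x : ℂ) • resolvent X (x : ℂ) = 1 + X * resolvent X (x : ℂ) := by
      have : (algebraMap ℂ A x - X) * resolvent X (x : ℂ) = 1 :=
        Ring.mul_inverse_cancel _ (spectrum.mem_resolventSet_iff.1
          (mem_resolventSet_of_norm_lt hX.isSelfAdjoint hx))
      rw [sub_mul, ← Algebra.smul_def] at this
      rw [← this]; abel
    rw [← smul_eq_mul, ← map_smul, ← mul_smul_comm, h1, mul_add, mul_one,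
      Ring.inverse_mul_cancel_left _ _ hX.isUnit, map_add]
  have memInv : ∀ {X : A}, IsStrictlyPositive X →
      Ring.inverse X ∈ (Algebra.adjoin ℂ {X}).topologicalClosure := fun {X} hX =>
    inverse_mem_topologicalClosure_adjoin hX.isSelfAdjoint
      (Subalgebra.le_topologicalClosure _ (Algebra.self_mem_adjoin_singleton ℂ X)) hX.isUnit
  have hxe : (x : ℂ) * (c * g + φ (Ring.inverse S * R)) = χ + g := by
    have := h.map_inverse_left_mul hRm
    rw [hφR] at this
    rw [← this, hRX _ (memInv hX), resX hX hx, hχC, map_resolvent_ofReal hφ hX.isSelfAdjoint, hgx]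
  have hye : (y : ℂ) * (φ (Ring.inverse S * R) + d * φ (Ring.inverse S * (Ring.inverse S * R)))
      = δ + g := by
    rw [← h.map_inverse_right_mul hφ hX hY hRm hSR, hRY _ (memInv hY), resX hY hy, hδC,
      map_resolvent_ofReal hφ hY.isSelfAdjoint, hgy]
  have hχe : (χ : ℂ) = c + σ := by
    have := h.map_inverse_left_mul (one_mem N)
    rwa [mul_one, mul_one, hφ.map_one, mul_one, hχC, hσC] at this
  have hδe : (δ : ℂ) = σ + d * σ₂ := by
    have := h.map_inverse_right_mul hφ hX hY (one_mem N) (Commute.one_right _)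
    rwa [mul_one, mul_one, hδC, hσC, hσ₂C] at this
  have hzC : (z : ℂ) ≠ 0 := by exact_mod_cast hz0.ne'
  have hkC : φ (Ring.inverse S * R) = (((σ + g) / z : ℝ) : ℂ) := by
    push_cast
    rw [eq_div_iff hzC, mul_comm, hz1]
  have hk₂C : φ (Ring.inverse S * (Ring.inverse S * R)) = (((σ₂ + (σ + g) / z) / z : ℝ) : ℂ) := by
    rw [hkC] at hz2
    push_cast at hz2 ⊢
    rw [eq_div_iff hzC, mul_comm, hz2]
  rw [hkC, hk₂C] at hye
  rw [hkC] at hxe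
  refine quadratic_of_subordination (k := (σ + g) / z) (k₂ := (σ₂ + (σ + g) / z) / z)
    (σ := σ) (σ₂ := σ₂) hz ?_ ?_ ?_ ?_ ?_ ?_ hg0 hz0 (hφ.re_pos hSp.ringInverse) ?_
  · field_simp
  · field_simp
  · exact_mod_cast hxe
  · exact_mod_cast hye
  · exact_mod_cast hχe
  · exact_mod_cast hδe
  · rw [hδ]; exact hφ.re_pos hY.ringInverse

end Regression

/-! ### Moments near infinity and the inequality cd > 1 -/

/-- Two power series in `1 / x` that agree for all large `x` have equal coefficients. -/
theorem eq_of_hasSum_inv_pow {p q : ℕ → ℝ} {R : ℝ} {F : ℝ → ℝ}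
    (hp : ∀ x, R < x → HasSum (fun n => p n * x⁻¹ ^ n) (F x))
    (hq : ∀ x, R < x → HasSum (fun n => q n * x⁻¹ ^ n) (F x)) : p = q := by
  suffices h : ∀ r : ℕ → ℝ, (∀ x, R < x → HasSum (fun n => r n * x⁻¹ ^ n) 0) → r = 0 by
    refine sub_eq_zero.1 (h (p - q) fun x hx => ?_)
    simpa [sub_mul] using (hp x hx).sub (hq x hx)
  intro r hr
  -- In u = 1/x the series converges at 1/x₀, so it has positive radius, and it vanishes on (0,
  -- 1/x₀), which accumulates at 0.
  set x₀ := max R 0 + 1 with hx₀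
  have hx₀0 : 0 < x₀ := by positivity
  have hx₀R : R < x₀ := by rw [hx₀]; linarith [le_max_left R 0]
  have hrad : ENNReal.ofReal x₀⁻¹ ≤ (FormalMultilinearSeries.ofScalars ℝ r).radius := by
    refine FormalMultilinearSeries.le_radius_of_summable_norm _ (r := x₀⁻¹.toNNReal) ?_
    have := (hr x₀ hx₀R).summable.norm
    refine this.congr fun n => ?_
    rw [FormalMultilinearSeries.ofScalars_norm, norm_mul, norm_pow,
      Real.coe_toNNReal _ (inv_nonneg.2 hx₀0.le), Real.norm_of_nonneg (inv_nonneg.2 hx₀0.le)]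
  have hpos : 0 < (FormalMultilinearSeries.ofScalars ℝ r).radius :=
    (ENNReal.ofReal_pos.2 (inv_pos.2 hx₀0)).trans_le hrad
  have hfps := (FormalMultilinearSeries.hasFPowerSeriesOnBall _ hpos).hasFPowerSeriesAt
  have hzero : ∀ u : ℝ, 0 < u → u < x₀⁻¹ →
      (FormalMultilinearSeries.ofScalars ℝ r).sum u = 0 := by
    intro u hu0 hu
    have h1 : R < u⁻¹ := hx₀R.trans ((lt_inv_comm₀ hu0 hx₀0).1 hu)
    have h2 := (hr _ h1).tsum_eq
    rw [inv_inv] at h2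
    rw [FormalMultilinearSeries.sum, ← h2]
    refine tsum_congr fun n => ?_
    rw [FormalMultilinearSeries.ofScalars_apply_eq, smul_eq_mul]
  have hfreq : ∃ᶠ u in nhdsWithin (0 : ℝ) {0}ᶜ,
      (FormalMultilinearSeries.ofScalars ℝ r).sum u = 0 := by
    have h1 : ∀ᶠ u in nhdsWithin (0 : ℝ) (Set.Ioi 0),
        (FormalMultilinearSeries.ofScalars ℝ r).sum u = 0 := by
      filter_upwards [Ioo_mem_nhdsGT (inv_pos.2 hx₀0)] with u hu
      exact hzero u hu.1 hu.2
    exact h1.frequently.filter_mono (nhdsWithin_mono _ fun u hu => ne_of_gt hu)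
  have hev := hfps.analyticAt.frequently_zero_iff_eventually_zero.1 hfreq
  have := (hfps.congr hev).eq_zero
  exact FormalMultilinearSeries.ofScalars_series_eq_zero ℝ |>.1 this

section Moments

variable {A : Type*} [CStarAlgebra A] [PartialOrder A] [StarOrderedRing A] {φ : A →ₗ[ℂ] ℂ}

theorem hasSum_moments (hφ : IsFaithfulNormalTracialState φ) {X : A} (hX : IsSelfAdjoint X)
    {x : ℝ} (hx : ‖X‖ < x) :
    HasSum (fun n => (φ (X ^ n)).re * x⁻¹ ^ n) (x * cauchyTransform φ X x) := by
  have hx0 : 0 < x := (norm_nonneg X).trans_lt hx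
  have hxC : (x : ℂ) ≠ 0 := by exact_mod_cast hx0.ne'
  have hlt : ‖(x : ℂ)⁻¹ • X‖ < 1 := by
    rw [norm_smul, norm_inv, Complex.norm_real, Real.norm_of_nonneg hx0.le, inv_mul_lt_one₀ hx0]
    exact hx
  have h1 := (hasSum_geom_series_inverse _ hlt).map φ hφ.continuous
  have h2 : Ring.inverse (1 - (x : ℂ)⁻¹ • X) = (x : ℂ) • resolvent X (x : ℂ) := by
    have hu : IsUnit (1 - (x : ℂ)⁻¹ • X) := isUnit_one_sub_of_norm_lt_one hlt
    refine inverse_eq_of_mul_eq_one hu ?_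
    have : (algebraMap ℂ A x - X) * resolvent X (x : ℂ) = 1 :=
      Ring.mul_inverse_cancel _ (spectrum.mem_resolventSet_iff.1
        (mem_resolventSet_of_norm_lt hX hx))
    rw [mul_smul_comm, ← smul_mul_assoc, smul_sub, smul_smul, mul_inv_cancel₀ hxC, one_smul,
      ← Algebra.algebraMap_eq_smul_one, this]
  rw [h2, map_smul, map_resolvent_ofReal hφ hX, smul_eq_mul] at h1
  have h3 := h1.mapL Complex.reCLM
  simp only [Complex.reCLM_apply] at h3
  convert h3 using 1
  · funext n
    simp only [Function.comp, smul_pow, map_smul, smul_eq_mul]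
    rw [← Complex.ofReal_inv, ← Complex.ofReal_pow, Complex.re_ofReal_mul, mul_comm]
  · rw [← Complex.ofReal_mul, Complex.ofReal_re]

variable {X Y : A} {N : Subalgebra ℂ A} {c d : ℝ}

theorem cauchyTransform_mul_norm_le (hφ : IsFaithfulNormalTracialState φ) (hX : 0 ≤ X) {r x : ℝ}
    (hr : 0 ≤ r) (hx : 8 * (‖X‖ + r) < x) :
    0 < cauchyTransform φ X x ∧ cauchyTransform φ X x * ‖X‖ ≤ 1 / 4 ∧
      cauchyTransform φ X x * r ≤ 1 / 4 := by
  have hX0 := norm_nonneg X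
  have hxX : ‖X‖ < x := by linarith
  have hx0 : 0 < x := hX0.trans_lt hxX
  have h1 := inv_le_cauchyTransform hφ hX hxX
  have h2 := cauchyTransform_le_inv hφ hX hxX
  have h3 : 0 < x - ‖X‖ := sub_pos.2 hxX
  refine ⟨(inv_pos.2 hx0).trans_le h1, ?_, ?_⟩
  · refine (mul_le_mul_of_nonneg_right h2 hX0).trans ?_
    rw [inv_mul_le_iff₀ h3]; linarith
  · refine (mul_le_mul_of_nonneg_right h2 hr).trans ?_
    rw [inv_mul_le_iff₀ h3]; linarith

theorem ConstantRegressions.quadratic_left (h : ConstantRegressions φ X Y N c d)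
    (hφ : IsFaithfulNormalTracialState φ) (hX : IsStrictlyPositive X) (hY : IsStrictlyPositive Y)
    (hfree : Free φ X Y) {x : ℝ} (hx : 8 * (‖X‖ + ‖Y‖) < x) :
    x ^ 2 * cauchyTransform φ X x *
        ((φ (Ring.inverse Y)).re - (c * d - 1) * cauchyTransform φ X x)
      + x * ((1 + 2 * (c * d - 1)) * cauchyTransform φ X x - (φ (Ring.inverse Y)).re)
      - d * (φ (Ring.inverse X)).re - d * cauchyTransform φ X x = 0 := by
  obtain ⟨h0, h1, h2⟩ := cauchyTransform_mul_norm_le hφ hX.nonneg (norm_nonneg Y) hx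
  obtain ⟨y, hy, hyg⟩ := exists_cauchyTransform_eq hφ hY.nonneg h0 (h2.trans_lt (by norm_num))
  have hxX : ‖X‖ < x := by linarith [norm_nonneg X, norm_nonneg Y]
  exact (h.quadratics hφ hX hY hfree hxX hy rfl hyg h1 h2 rfl rfl).2

theorem ConstantRegressions.quadratic_right (h : ConstantRegressions φ X Y N c d)
    (hφ : IsFaithfulNormalTracialState φ) (hX : IsStrictlyPositive X) (hY : IsStrictlyPositive Y)
    (hfree : Free φ X Y) {y : ℝ} (hy : 8 * (‖Y‖ + ‖X‖) < y) :
    y * cauchyTransform φ Y y * ((φ (Ring.inverse Y)).re - (c * d - 1) * cauchyTransform φ Y y)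
      = (φ (Ring.inverse Y)).re + cauchyTransform φ Y y := by
  obtain ⟨h0, h1, h2⟩ := cauchyTransform_mul_norm_le hφ hY.nonneg (norm_nonneg X) hy
  obtain ⟨x, hx, hxg⟩ := exists_cauchyTransform_eq hφ hX.nonneg h0 (h2.trans_lt (by norm_num))
  have hyY : ‖Y‖ < y := by linarith [norm_nonneg X, norm_nonneg Y]
  exact (h.quadratics hφ hX hY hfree hx hyY hxg rfl h2 h1 rfl rfl).1

/-- Here d = φ(V⁻¹) = φ(X Y⁻¹ X) + φ(X). -/
theorem ConstantRegressions.pos (h : ConstantRegressions φ X Y N c d)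
    (hφ : IsFaithfulNormalTracialState φ) (hX : IsStrictlyPositive X)
    (hY : IsStrictlyPositive Y) : 0 < d := by
  have h1 := h.map_inverse_mul 1 (one_mem N)
  rw [mul_one, hφ.map_one, mul_one, inverse_inverse_sub_inverse_add hX hY, mul_add,
    mul_assoc X (Ring.inverse Y) Y, Ring.inverse_mul_cancel _ hY.isUnit, mul_one, map_add] at h1
  have h2 : 0 ≤ X * Ring.inverse Y * X := by
    simpa [hX.isSelfAdjoint.star_eq] using
      star_left_conjugate_nonneg hY.ringInverse.nonneg X
  have h3 := (Complex.le_def.1 (hφ.nonneg _ h2)).1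
  have h4 := congrArg Complex.re h1
  simp only [Complex.add_re, Complex.ofReal_re, Complex.zero_re] at h3 h4
  linarith [hφ.re_pos hX]

theorem hasDistribution_of_moments (hφ : IsFaithfulNormalTracialState φ) (hX : IsSelfAdjoint X)
    {μ : Measure ℝ} (hμ : IsProbabilityMeasure μ) (hc : ∃ K : Set ℝ, IsCompact K ∧ μ Kᶜ = 0)
    (h : ∀ n, (φ (X ^ n)).re = ∫ t, t ^ n ∂μ) : HasDistribution φ X μ :=
  ⟨hμ, hc, fun n => by rw [hφ.eq_re_of_isSelfAdjoint (hX.pow n), h n]⟩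

/-- With F = yG(y), the quadratic reads F + (cd - 1)F² = δy(F - 1). As y grows, F tends to 1 and the
left side to cd, while the right side is at least δφ(Y) ≥ 1. Hence cd < 1 is impossible. If cd = 1,
then G(y) = 1/(y - 1/δ), the transform of a point mass. -/
theorem ConstantRegressions.one_lt_mul (h : ConstantRegressions φ X Y N c d)
    (hφ : IsFaithfulNormalTracialState φ) (hX : IsStrictlyPositive X) (hY : IsStrictlyPositive Y)
    (hfree : Free φ X Y) (hnd : NonDegenerate φ Y) : 1 < c * d := by
  set δ := (φ (Ring.inverse Y)).re with hδ
  have hδ0 : 0 < δ := hφ.re_pos hY.ringInverse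
  have hX0 := norm_nonneg X
  have hY0 := norm_nonneg Y
  by_contra! hcd
  rcases hcd.lt_or_eq with hlt | heq
  -- Large enough that (1 - cd)(y - ‖Y‖) > ‖Y‖, against the reverse inequality that follows from 1 -
  -- cd ≤ G(y)‖Y‖ and G(y) ≤ 1/(y - ‖Y‖).
  · set y := 8 * (‖Y‖ + ‖X‖) + 1 + ‖Y‖ + ‖Y‖ / (1 - c * d) + (φ Y).re with hy
    have hm0 := hφ.re_pos hY
    have he : 0 < 1 - c * d := by linarith
    have hq : 0 ≤ ‖Y‖ / (1 - c * d) := by positivity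
    have hyR : 8 * (‖Y‖ + ‖X‖) < y := by linarith
    have hyY : ‖Y‖ < y := by linarith
    have hquad := h.quadratic_right hφ hX hY hfree hyR
    rw [← hδ] at hquad
    have h1 := inv_le_cauchyTransform hφ hY.nonneg hyY
    have h2 := cauchyTransform_le_inv hφ hY.nonneg hyY
    have h3 := hφ.one_le_mul (isStrictlyPositive_algebraMap_sub hY.isSelfAdjoint hyY)
    have h4 := hφ.one_le_mul hY
    rw [← resolvent_ofReal, map_sub, hφ.map_algebraMap_real, Complex.sub_re, Complex.ofReal_re]
      at h3
    change 1 ≤ _ * cauchyTransform φ Y y at h3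
    set g := cauchyTransform φ Y y
    have hy0 : 0 < y := by linarith
    have hg1 : 1 ≤ g * y := by rwa [inv_le_iff_one_le_mul₀ hy0] at h1
    have hg2 : g * (y - ‖Y‖) ≤ 1 := by rwa [← one_div, le_div_iff₀ (sub_pos.2 hyY)] at h2
    have hg0 : 0 < g := (inv_pos.2 hy0).trans_le h1
    set F := g * y with hF
    have hF1 : F + (c * d - 1) * F ^ 2 = δ * (y * (F - 1)) := by
      linear_combination (-y) * hquad
    have hF2 : (φ Y).re ≤ y * (F - 1) := by
      have : (φ Y).re * g ≤ F - 1 := by linarith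
      have h5 : (φ Y).re * 1 ≤ (φ Y).re * (g * y) := mul_le_mul_of_nonneg_left hg1 hm0.le
      have h6 := mul_le_mul_of_nonneg_left this hy0.le
      linarith
    have hF3 : 1 ≤ F + (c * d - 1) * F ^ 2 := by
      rw [hF1]
      have h5 := mul_le_mul_of_nonneg_left hF2 hδ0.le
      linarith
    have hF4 : F - 1 ≤ g * ‖Y‖ := by linarith
    have hF5 : 1 - c * d ≤ g * ‖Y‖ := by
      have h7 := mul_le_mul_of_nonneg_left (one_le_pow₀ hg1 (n := 2)) he.le
      linarith
    have hF6 : ‖Y‖ < (1 - c * d) * (y - ‖Y‖) := by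
      have : ‖Y‖ = (1 - c * d) * (‖Y‖ / (1 - c * d)) := by field_simp
      have h6 : ‖Y‖ / (1 - c * d) < y - ‖Y‖ := by linarith
      calc ‖Y‖ = (1 - c * d) * (‖Y‖ / (1 - c * d)) := this
        _ < _ := mul_lt_mul_of_pos_left h6 he
    have h8 := mul_le_mul_of_nonneg_right hF5 (sub_pos.2 hyY).le
    have h9 := mul_le_mul_of_nonneg_left hg2 hY0
    linarith
  · have hmom : (fun n => (φ (Y ^ n)).re) = fun n => δ⁻¹ ^ n := by
      refine eq_of_hasSum_inv_pow (R := 8 * (‖Y‖ + ‖X‖) + δ⁻¹)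
        (F := fun y => y * cauchyTransform φ Y y) (fun y hy => ?_) (fun y hy => ?_)
      · have := inv_pos.2 hδ0
        exact hasSum_moments hφ hY.isSelfAdjoint (by linarith)
      · have hδi := inv_pos.2 hδ0
        have hquad := h.quadratic_right hφ hX hY hfree (y := y) (by linarith)
        rw [← hδ, heq] at hquad
        have hy0 : 0 < y := by linarith
        have hyδ : δ⁻¹ < y := by linarith
        have hlt : δ⁻¹ * y⁻¹ < 1 := by rwa [mul_inv_lt_iff₀ hy0, one_mul]
        have hs := hasSum_geometric_of_lt_one (r := δ⁻¹ * y⁻¹) (by positivity) hlt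
        simp only [mul_pow] at hs
        convert hs using 1
        refine eq_inv_of_mul_eq_one_left ?_
        field_simp
        linarith
    refine hnd δ⁻¹ (hasDistribution_of_moments hφ hY.isSelfAdjoint inferInstance
      ⟨{δ⁻¹}, isCompact_singleton, by simp⟩ fun n => ?_)
    rw [integral_dirac]
    exact congrFun hmom n

end Moments

/-! ### Roots of the quartic discriminant -/

/-- The four equations compare the coefficients of x³, x², x and 1 with those of (x - r)²(α²x² + px
+ s); a root at which the derivative also vanishes is double. Coefficient form lets the
factorization be transferred to ℂ by `factor_eval`. -/
theorem exists_double_root_factorization {α β l k r : ℝ}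
    (h0 : (α * r ^ 2 + l * r - β) ^ 2 - 4 * r ^ 2 * (α * r + k) = 0)
    (h1 : 2 * (α * r ^ 2 + l * r - β) * (2 * α * r + l) - 8 * r * (α * r + k) - 4 * r ^ 2 * α = 0) :
    ∃ p s : ℝ, (α * l * 2 - 4 * α = p - 2 * r * α ^ 2) ∧
      (l ^ 2 - 2 * α * β - 4 * k = s - 2 * r * p + r ^ 2 * α ^ 2) ∧
      (-2 * l * β = r ^ 2 * p - 2 * r * s) ∧ β ^ 2 = r ^ 2 * s := by
  set p := α * l * 2 - 4 * α + 2 * r * α ^ 2 with hp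
  set s := l ^ 2 - 2 * α * β - 4 * k + 2 * r * p - r ^ 2 * α ^ 2 with hs
  have e1 : -2 * l * β = r ^ 2 * p - 2 * r * s := by
    rw [hs, hp]; linear_combination h1
  refine ⟨p, s, by rw [hp]; ring, by rw [hs]; ring, e1, ?_⟩
  rw [hs, hp] at *
  linear_combination h0 - r * h1

theorem factor_eval {R : Type*} [CommRing R] [Algebra ℝ R] {α β l k r p s : ℝ}
    (h3 : α * l * 2 - 4 * α = p - 2 * r * α ^ 2)
    (h2 : l ^ 2 - 2 * α * β - 4 * k = s - 2 * r * p + r ^ 2 * α ^ 2)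
    (h1 : -2 * l * β = r ^ 2 * p - 2 * r * s) (h0 : β ^ 2 = r ^ 2 * s) (x : R) :
    (algebraMap ℝ R α * x ^ 2 + algebraMap ℝ R l * x - algebraMap ℝ R β) ^ 2
      - 4 * x ^ 2 * (algebraMap ℝ R α * x + algebraMap ℝ R k)
    = (x - algebraMap ℝ R r) ^ 2 *
      (algebraMap ℝ R α ^ 2 * x ^ 2 + algebraMap ℝ R p * x + algebraMap ℝ R s) := by
  have h3' := congrArg (algebraMap ℝ R) h3
  have h2' := congrArg (algebraMap ℝ R) h2
  have h1' := congrArg (algebraMap ℝ R) h1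
  have h0' := congrArg (algebraMap ℝ R) h0
  simp only [map_sub, map_add, map_mul, map_pow, map_ofNat, map_neg] at h3' h2' h1' h0'
  linear_combination x ^ 3 * h3' + x ^ 2 * h2' + x * h1' + h0'

/-- If the quartic `(αx² + lx - β)² - 4x²(αx + k)` is the square of `2x²G - (αx² + lx - β)` on the
nonpositive half-line for a negative continuous `G` and has no simple nonreal roots, then it has two
simple positive roots and a negative double root. -/
theorem exists_roots_of_sq {α β l k : ℝ} (hα : 0 < α) (hβ : 0 < β) {G : ℝ → ℝ}
    (hGc : ContinuousOn G (Set.Iic 0)) (hG : ∀ x < 0, G x < 0)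
    (hsq : ∀ x < 0, (2 * x ^ 2 * G x - (α * x ^ 2 + l * x - β)) ^ 2 =
      (α * x ^ 2 + l * x - β) ^ 2 - 4 * x ^ 2 * (α * x + k))
    (hC : ∀ ρ : ℂ, ρ.im ≠ 0 → (α * ρ ^ 2 + l * ρ - β) ^ 2 - 4 * ρ ^ 2 * (α * ρ + k) = 0 →
      2 * (α * ρ ^ 2 + l * ρ - β) * (2 * α * ρ + l) - 8 * ρ * (α * ρ + k) - 4 * ρ ^ 2 * α = 0) :
    ∃ a b : ℝ, 0 < a ∧ a < b ∧ ∀ x : ℝ, (α * x ^ 2 + l * x - β) ^ 2 - 4 * x ^ 2 * (α * x + k) =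
      (α * x + β / √(a * b)) ^ 2 * ((x - a) * (x - b)) := by
  set Q : ℝ → ℝ := fun x => (α * x ^ 2 + l * x - β) ^ 2 - 4 * x ^ 2 * (α * x + k) with hQ
  set Hf : ℝ → ℝ := fun x => 2 * x ^ 2 * G x - (α * x ^ 2 + l * x - β) with hHf
  have hHc : ContinuousOn Hf (Set.Iic 0) := by
    refine ContinuousOn.sub (ContinuousOn.mul (by fun_prop) hGc) (by fun_prop)
  have hH0 : Hf 0 = β := by simp [hHf]
  have hQ0 : ∀ x < 0, 0 ≤ Q x := fun x hx => by
    have := hsq x hx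
    change _ = Q x at this
    rw [← this]; positivity
  -- a negative root of `Hf`
  set K := (|l| + β) / α + 1 with hK
  have hK1 : 1 ≤ K := by
    have : 0 ≤ (|l| + β) / α := by positivity
    linarith
  have hKα : α * K = |l| + β + α := by rw [hK]; field_simp
  have hHK : Hf (-K) < 0 := by
    have h1 := hG (-K) (by linarith)
    have h2 : 0 < α * (-K) ^ 2 + l * (-K) - β := by
      have : α * (-K) ^ 2 + l * (-K) - β = K * (α * K - l) - β := by ring
      rw [this, hKα]
      have h3 := le_abs_self l
      nlinarith
    have h4 : 2 * (-K) ^ 2 * G (-K) ≤ 0 :=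
      mul_nonpos_of_nonneg_of_nonpos (by positivity) h1.le
    simp only [hHf]
    linarith
  obtain ⟨r, hr, hr0⟩ : ∃ r ∈ Set.Ioo (-K) 0, Hf r = 0 := by
    have := intermediate_value_Ioo (f := Hf) (show -K ≤ 0 by linarith)
      (hHc.mono fun x hx => hx.2)
    exact this ⟨hHK, by rw [hH0]; exact hβ⟩
  have hrneg : r < 0 := hr.2
  have hQr : Q r = 0 := by
    have := hsq r hrneg
    change Hf r ^ 2 = Q r at this
    rw [← this, hr0]; ring
  have hQd : ∀ x, HasDerivAt Q (2 * (α * x ^ 2 + l * x - β) * (2 * α * x + l)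
      - 8 * x * (α * x + k) - 4 * x ^ 2 * α) x := by
    intro x
    have h1 : HasDerivAt (fun x : ℝ => α * x ^ 2 + l * x - β) (2 * α * x + l) x := by
      have := (((hasDerivAt_pow 2 x).const_mul α).add ((hasDerivAt_id x).const_mul l)).sub_const β
      refine this.congr_deriv ?_
      simp; ring
    have h2 : HasDerivAt (fun x : ℝ => 4 * x ^ 2 * (α * x + k)) (8 * x * (α * x + k)
        + 4 * x ^ 2 * α) x := by
      have := ((hasDerivAt_pow 2 x).const_mul 4).mul
        (((hasDerivAt_id x).const_mul α).add_const k)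
      refine this.congr_deriv ?_
      simp only [id_eq, Nat.reduceSub, pow_one, Nat.cast_ofNat]
      ring
    refine ((h1.pow 2).sub h2).congr_deriv ?_
    simp; ring
  have hQd0 : 2 * (α * r ^ 2 + l * r - β) * (2 * α * r + l)
      - 8 * r * (α * r + k) - 4 * r ^ 2 * α = 0 := by
    -- Being a square, Q is nonnegative on the negative axis, so its zero r there is a minimum and
    -- hence a double root.
    have hmin : IsLocalMin Q r := by
      filter_upwards [Iio_mem_nhds hrneg] with x hx
      rw [hQr]; exact hQ0 x hx
    exact hmin.hasDerivAt_eq_zero (hQd r)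
  obtain ⟨p, s, e3, e2, e1, e0⟩ := exists_double_root_factorization hQr hQd0
  have hfac : ∀ x : ℝ, Q x = (x - r) ^ 2 * (α ^ 2 * x ^ 2 + p * x + s) := fun x =>
    factor_eval (R := ℝ) e3 e2 e1 e0 x
  have hr2 : 0 < r ^ 2 := by
    have := hrneg.ne
    positivity
  have hs0 : 0 < s := by
    have : 0 < r ^ 2 * s := e0 ▸ by positivity
    exact pos_of_mul_pos_right this hr2.le
  rcases lt_trichotomy (p ^ 2 - 4 * α ^ 2 * s) 0 with hΔ | hΔ | hΔ
  -- Nonreal roots of the quadratic factor would be simple roots of Q, against `hC`.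
  · exfalso
    set t := √(4 * α ^ 2 * s - p ^ 2) with ht
    have ht0 : 0 < t := Real.sqrt_pos.2 (by linarith)
    have ht2 : t ^ 2 = 4 * α ^ 2 * s - p ^ 2 := Real.sq_sqrt (by linarith)
    have hαC : (α : ℂ) ≠ 0 := by exact_mod_cast hα.ne'
    set ρ : ℂ := (-p + t * Complex.I) / (2 * α ^ 2) with hρ
    have hρim : ρ.im ≠ 0 := by
      have : ρ = ((-p / (2 * α ^ 2) : ℝ) : ℂ) + ((t / (2 * α ^ 2) : ℝ) : ℂ) * Complex.I := by
        rw [hρ]; push_cast; ring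
      rw [this]
      simp only [Complex.add_im, Complex.ofReal_im, Complex.mul_im, Complex.I_im, Complex.I_re,
        Complex.ofReal_re, mul_one, mul_zero, zero_add, add_zero]
      positivity
    have hρe : 2 * (α : ℂ) ^ 2 * ρ = -p + t * Complex.I := by
      rw [hρ]; field_simp
    have htC : (t : ℂ) ^ 2 = 4 * α ^ 2 * s - p ^ 2 := by exact_mod_cast ht2
    have hq : (α : ℂ) ^ 2 * ρ ^ 2 + p * ρ + s = 0 := by
      have h4 : 4 * (α : ℂ) ^ 2 ≠ 0 := by positivity
      refine mul_left_cancel₀ h4 ?_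
      linear_combination (2 * (α : ℂ) ^ 2 * ρ + p + t * Complex.I) * hρe
        + t ^ 2 * Complex.I_sq - htC
    have hfC := factor_eval (R := ℂ) e3 e2 e1 e0
    simp only [Complex.coe_algebraMap] at hfC
    have hd := hC ρ hρim (by rw [hfC ρ, hq, mul_zero])
    have e3' : (α * l * 2 - 4 * α : ℂ) = p - 2 * r * α ^ 2 := by exact_mod_cast e3
    have e2' : (l ^ 2 - 2 * α * β - 4 * k : ℂ) = s - 2 * r * p + r ^ 2 * α ^ 2 := by
      exact_mod_cast e2
    have e1' : (-2 * l * β : ℂ) = r ^ 2 * p - 2 * r * s := by exact_mod_cast e1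
    have hd2 : (ρ - r) ^ 2 * (2 * α ^ 2 * ρ + p) = 0 := by
      linear_combination hd - 2 * (ρ - r) * hq - 3 * ρ ^ 2 * e3' - 2 * ρ * e2' - e1'
    rcases mul_eq_zero.1 hd2 with h | h
    · have : ρ = r := sub_eq_zero.1 (by simpa using h)
      exact hρim (by rw [this]; simp)
    · rw [hρe] at h
      have : (t : ℂ) * Complex.I = 0 := by linear_combination h
      simp [ht0.ne'] at this
  -- A double root v makes Q the square of a polynomial. Then `Hf` is a polynomial just left of 0,
  -- and `G` is a nonnegative constant there, contradicting its sign.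
  · exfalso
    obtain ⟨v, hv⟩ : ∃ v, v = -p / (2 * α ^ 2) := ⟨_, rfl⟩
    have hvp : p = -2 * α ^ 2 * v := by rw [hv]; field_simp
    have hvs : s = α ^ 2 * v ^ 2 := by
      have h4 : 4 * α ^ 2 ≠ 0 := by positivity
      refine mul_left_cancel₀ h4 ?_
      rw [hvp] at hΔ
      linear_combination -hΔ
    have hK2 : ∀ x, Q x = (α * ((x - r) * (x - v))) ^ 2 := by
      intro x
      rw [hfac, hvs, hvp]; ring
    have hK0 : (α * (r * v)) ^ 2 = β ^ 2 := by
      rw [e0, hvs]; ring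
    -- The sign for which the polynomial root of Q agrees with `Hf` at 0; both are positive nearby,
    -- so their equal squares make them equal.
    obtain ⟨ε, hε, hε0⟩ : ∃ ε : ℝ, (ε = 1 ∨ ε = -1) ∧ ε * (α * (r * v)) = β := by
      rcases sq_eq_sq_iff_eq_or_eq_neg.1 hK0 with h | h
      · exact ⟨1, .inl rfl, by rw [h, one_mul]⟩
      · exact ⟨-1, .inr rfl, by rw [h]; ring⟩
    have hε2 : ε ^ 2 = 1 := by rcases hε with h | h <;> rw [h] <;> norm_num
    have hε1 : 0 ≤ 1 + ε := by rcases hε with h | h <;> rw [h] <;> norm_num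
    have hle : nhdsWithin (0 : ℝ) (Set.Iio 0) ≤ nhdsWithin 0 (Set.Iic 0) :=
      nhdsWithin_mono _ Set.Iio_subset_Iic_self
    have hH : ∀ᶠ x in nhdsWithin (0 : ℝ) (Set.Iio 0), 0 < Hf x :=
      ((hHc 0 Set.self_mem_Iic).mono_left hle).eventually_const_lt (by rw [hH0]; exact hβ)
    have hKp : ∀ᶠ x in nhdsWithin (0 : ℝ) (Set.Iio 0), 0 < ε * (α * ((x - r) * (x - v))) := by
      have hc : Continuous fun x : ℝ => ε * (α * ((x - r) * (x - v))) := by fun_prop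
      refine (hc.continuousAt.tendsto.mono_left nhdsWithin_le_nhds).eventually_const_lt ?_
      simpa [hε0] using hβ
    have hlin : ∀ᶠ x in nhdsWithin (0 : ℝ) (Set.Iio 0),
        2 * x * G x = (l - ε * α * (r + v)) + α * (1 + ε) * x := by
      filter_upwards [hH, hKp, self_mem_nhdsWithin] with x h1 h2 (hx : x < 0)
      have h3 : Hf x ^ 2 = (ε * (α * ((x - r) * (x - v)))) ^ 2 := by
        rw [mul_pow, hε2, one_mul, ← hK2]
        exact hsq x hx
      have h4 := (pow_left_inj₀ h1.le h2.le two_ne_zero).1 h3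
      refine mul_left_cancel₀ hx.ne ?_
      simp only [hHf] at h4
      linear_combination h4 + hε0
    have hlim1 : Filter.Tendsto (fun x => 2 * x * G x) (nhdsWithin (0 : ℝ) (Set.Iio 0))
        (nhds (2 * 0 * G 0)) := by
      refine Filter.Tendsto.mul ?_ ((hGc 0 Set.self_mem_Iic).mono_left hle)
      exact (Continuous.tendsto (by fun_prop) 0).mono_left nhdsWithin_le_nhds
    have hlim2 : Filter.Tendsto (fun x => (l - ε * α * (r + v)) + α * (1 + ε) * x)
        (nhdsWithin (0 : ℝ) (Set.Iio 0)) (nhds ((l - ε * α * (r + v)) + α * (1 + ε) * 0)) :=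
      (Continuous.tendsto (by fun_prop) 0).mono_left nhdsWithin_le_nhds
    -- Continuity of `G` at 0, that is, invertibility of the variable, excludes a pole there.
    have hk1 : l - ε * α * (r + v) = 0 := by
      have := tendsto_nhds_unique (hlim1.congr' hlin) hlim2
      simp only [mul_zero, zero_mul, add_zero] at this
      exact this.symm
    obtain ⟨x, hx1, hx2⟩ := (hlin.and self_mem_nhdsWithin).exists
    have hx2 : x < 0 := hx2
    have h5 : 2 * G x = α * (1 + ε) := by
      refine mul_left_cancel₀ hx2.ne ?_
      linear_combination hx1 + hk1
    have h6 := hG x hx2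
    have h7 : 0 ≤ α * (1 + ε) := by positivity
    linarith
  · set t := √(p ^ 2 - 4 * α ^ 2 * s) with ht
    have ht0 : 0 < t := Real.sqrt_pos.2 hΔ
    have ht2 : t ^ 2 = p ^ 2 - 4 * α ^ 2 * s := Real.sq_sqrt hΔ.le
    obtain ⟨a, ha⟩ : ∃ a, a = (-p - t) / (2 * α ^ 2) := ⟨_, rfl⟩
    obtain ⟨b, hb⟩ : ∃ b, b = (-p + t) / (2 * α ^ 2) := ⟨_, rfl⟩
    have hα2 : 0 < 2 * α ^ 2 := by positivity
    have hab : a < b := by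
      rw [ha, hb]; exact div_lt_div_of_pos_right (by linarith) hα2
    have hae : 2 * α ^ 2 * a = -p - t := by rw [ha]; field_simp
    have hbe : 2 * α ^ 2 * b = -p + t := by rw [hb]; field_simp
    have hsum : α ^ 2 * (a + b) = -p := by linarith
    have hprod : α ^ 2 * (a * b) = s := by
      have h4 : 4 * α ^ 2 ≠ 0 := by positivity
      refine mul_left_cancel₀ h4 ?_
      linear_combination (2 * α ^ 2 * b) * hae + (-p - t) * hbe - ht2
    have hqf : ∀ x : ℝ, α ^ 2 * x ^ 2 + p * x + s = α ^ 2 * ((x - a) * (x - b)) := by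
      intro x
      linear_combination x * hsum - hprod
    have hab0 : 0 < a * b := by
      have : 0 < α ^ 2 * (a * b) := by rw [hprod]; exact hs0
      exact pos_of_mul_pos_right this (by positivity)
    have ha0 : 0 < a := by
      by_contra! ha'
      have ha'' : a < 0 := lt_of_le_of_ne ha' (by rintro h; simp [h] at hab0)
      have hb' : b < 0 := by
        by_contra! hb'
        exact absurd hab0 (not_lt.2 (mul_nonpos_of_nonpos_of_nonneg ha' hb'))
      -- If both roots were negative, Q would be negative at such a point of the negative axis.
      obtain ⟨x, hx1, hx2, hxr⟩ : ∃ x, a < x ∧ x < b ∧ x ≠ r := by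
        by_cases h : (a + b) / 2 = r
        · exact ⟨(a + r) / 2, by linarith, by linarith, by linarith⟩
        · exact ⟨(a + b) / 2, by linarith, by linarith, h⟩
      have h1 := hQ0 x (by linarith)
      rw [hfac, hqf] at h1
      have h2 : 0 < (x - r) ^ 2 := by
        have := sub_ne_zero.2 hxr
        positivity
      have h3 : (x - a) * (x - b) < 0 := mul_neg_of_pos_of_neg (by linarith) (by linarith)
      have h4 : α ^ 2 * ((x - a) * (x - b)) < 0 := mul_neg_of_pos_of_neg (by positivity) h3
      have h5 := mul_neg_of_pos_of_neg h2 h4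
      linarith
    refine ⟨a, b, ha0, hab, fun x => ?_⟩
    have hsq0 : 0 < √(a * b) := Real.sqrt_pos.2 hab0
    -- The squares agree because β² = r²s and s = α²ab; both sides are positive because r < 0.
    have hη : β / √(a * b) = -(α * r) := by
      rw [div_eq_iff hsq0.ne']
      have h1 : 0 < -(α * r) * √(a * b) := mul_pos (by nlinarith) hsq0
      have h2 : β ^ 2 = (-(α * r) * √(a * b)) ^ 2 := by
        rw [mul_pow, Real.sq_sqrt hab0.le, e0, ← hprod]; ring
      exact (pow_left_inj₀ hβ.le h1.le two_ne_zero).1 h2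
    have := hfac x
    rw [hqf] at this
    change Q x = _
    rw [this, hη]; ring

/-! ### Analytic continuation of the quadratic equation -/

section CauchyTransform

variable {A : Type*} [CStarAlgebra A] {φ : A →ₗ[ℂ] ℂ} {X : A}

theorem inverse_one_sub_inv_smul {z : ℂ} (hz0 : z ≠ 0) (hz : z ∈ resolventSet ℂ X) :
    Ring.inverse (1 - z⁻¹ • X) = z • resolvent X z := by
  have hu := spectrum.mem_resolventSet_iff.1 hz
  have e : 1 - z⁻¹ • X = algebraMap ℂ A z⁻¹ * (algebraMap ℂ A z - X) := by
    rw [mul_sub, ← map_mul, inv_mul_cancel₀ hz0, map_one, ← Algebra.smul_def]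
  have hu' : IsUnit (1 - z⁻¹ • X) := by
    rw [e]; exact ((isUnit_iff_ne_zero.2 (inv_ne_zero hz0)).map _).mul hu
  refine inverse_eq_of_mul_eq_one hu' ?_
  rw [e, ← Algebra.smul_def, smul_mul_smul_comm, inv_mul_cancel₀ hz0, one_smul]
  exact Ring.mul_inverse_cancel _ hu

variable [PartialOrder A] [StarOrderedRing A]

theorem exists_ofReal_of_mem_spectrum (hX : 0 ≤ X) {z : ℂ} (hz : z ∈ spectrum ℂ X) :
    ∃ t : ℝ, 0 ≤ t ∧ t ≤ ‖X‖ ∧ z = t := by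
  have hre := hX.isSelfAdjoint.mem_spectrum_eq_re hz
  have hzR : z.re ∈ spectrum ℝ X := by
    rw [spectrum.mem_iff, ← algebraMap_ofReal]
    rw [spectrum.mem_iff, hre] at hz
    exact hz
  have h0 : 0 ≤ z.re := spectrum_nonneg_of_nonneg hX hzR
  refine ⟨z.re, h0, ?_, hre⟩
  by_contra! h
  have := mem_resolventSet_of_norm_lt hX.isSelfAdjoint h
  rw [← hre] at this
  exact hz this

theorem mem_resolventSet_of_im_ne_zero_or_re_neg (hX : 0 ≤ X) {z : ℂ}
    (hz : z.im ≠ 0 ∨ z.re < 0) : z ∈ resolventSet ℂ X := by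
  by_contra h
  obtain ⟨t, ht0, -, rfl⟩ := exists_ofReal_of_mem_spectrum hX h
  rcases hz with hz | hz
  · simp at hz
  · simp only [Complex.ofReal_re] at hz; linarith

theorem isUnit_one_sub_smul (hX : 0 ≤ X) {u : ℂ} (hu : 1 - ‖X‖ * u ∈ Complex.slitPlane) :
    IsUnit (1 - u • X) := by
  rcases eq_or_ne u 0 with rfl | h0
  · simp
  · by_contra h
    have hmem : u⁻¹ ∈ spectrum ℂ X := by
      rw [spectrum.mem_iff]
      intro h1
      apply h
      have : 1 - u • X = algebraMap ℂ A u * (algebraMap ℂ A u⁻¹ - X) := by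
        rw [mul_sub, ← map_mul, mul_inv_cancel₀ h0, map_one, ← Algebra.smul_def]
      rw [this]
      exact ((isUnit_iff_ne_zero.2 h0).map _).mul h1
    obtain ⟨t, ht0, htX, ht⟩ := exists_ofReal_of_mem_spectrum hX hmem
    have htne : t ≠ 0 := by
      rintro rfl
      simp [h0] at ht
    have htpos : 0 < t := lt_of_le_of_ne ht0 htne.symm
    have hut : u = ((t⁻¹ : ℝ) : ℂ) := by rw [← inv_inv u, ht]; simp
    rw [hut, ← Complex.ofReal_mul, ← Complex.ofReal_one, ← Complex.ofReal_sub,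
      Complex.ofReal_mem_slitPlane] at hu
    have : 1 ≤ ‖X‖ * t⁻¹ := by rwa [← div_eq_mul_inv, one_le_div htpos]
    linarith

/-- A quadratic equation for the Cauchy transform near infinity extends off the real half-line. -/
theorem quadratic_resolvent (hφ : IsFaithfulNormalTracialState φ) (hX : 0 ≤ X) {α β l k R : ℝ}
    (h : ∀ x, R < x → x ^ 2 * cauchyTransform φ X x ^ 2
      - (α * x ^ 2 + l * x - β) * cauchyTransform φ X x + α * x + k = 0)
    {z : ℂ} (hz : z.im ≠ 0 ∨ z.re < 0) :
    z ^ 2 * φ (resolvent X z) ^ 2 - (α * z ^ 2 + l * z - β) * φ (resolvent X z) + α * z + k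
      = 0 := by
  -- The coordinate is u = 1/z, so infinity becomes the interior point 0. W is star-shaped about 0,
  -- and 1 - uX is invertible on it; with F(1/z) = zG(z) the identity theorem applies at u = 0.
  set W : Set ℂ := (fun u : ℂ => 1 - ‖X‖ * u) ⁻¹' Complex.slitPlane with hW
  have hWo : IsOpen W := Complex.isOpen_slitPlane.preimage (by fun_prop)
  have hW0 : (0 : ℂ) ∈ W := by simp [hW]
  have hWc : IsPreconnected W := by
    have hstar : StarConvex ℝ (0 : ℂ) W := by
      intro u hu a b ha hb hab
      have := Complex.starConvex_one_slitPlane hu ha hb hab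
      have hab' : (a : ℂ) + b = 1 := by exact_mod_cast hab
      change 1 - (‖X‖ : ℂ) * (a • (0 : ℂ) + b • u) ∈ Complex.slitPlane
      convert this using 1
      simp only [Complex.real_smul]
      linear_combination -hab'
    exact (hstar.isPathConnected hW0).isConnected.isPreconnected
  set F : ℂ → ℂ := fun u => φ (Ring.inverse (1 - u • X)) with hF
  have hFd : DifferentiableOn ℂ F W := by
    intro u hu
    have h1 : DifferentiableAt ℂ (fun u : ℂ => Ring.inverse (1 - u • X)) u := by
      obtain ⟨v, hv⟩ := isUnit_one_sub_smul hX hu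
      have h2 : DifferentiableAt ℂ (Ring.inverse : A → A) (1 - u • X) := by
        rw [← hv]; exact differentiableAt_inverse v.isUnit
      exact DifferentiableAt.comp (f := fun u : ℂ => 1 - u • X) u h2 (by fun_prop)
    let φL : A →L[ℂ] ℂ := ⟨φ, hφ.continuous⟩
    exact (φL.differentiableAt.comp u h1).differentiableWithinAt
  set Φ : ℂ → ℂ := fun u => u * F u ^ 2 - (α + l * u - β * u ^ 2) * F u + α + k * u with hΦ
  have hΦd : DifferentiableOn ℂ Φ W := by
    simp only [hΦ]; fun_prop
  have hFz : ∀ z : ℂ, z ≠ 0 → z ∈ resolventSet ℂ X → F z⁻¹ = z * φ (resolvent X z) := by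
    intro z hz0 hz
    simp only [hF]
    rw [inverse_one_sub_inv_smul hz0 hz, map_smul, smul_eq_mul]
  have hfreq : ∃ᶠ u in nhdsWithin (0 : ℂ) {0}ᶜ, Φ u = 0 := by
    have h1 : ∃ᶠ t : ℝ in nhdsWithin (0 : ℝ) (Set.Ioi 0), Φ (t : ℂ) = 0 := by
      refine Filter.Eventually.frequently ?_
      set r := max (max R ‖X‖) 0 + 1 with hr
      have hr0 : 0 < r := by positivity
      filter_upwards [Ioo_mem_nhdsGT (inv_pos.2 hr0)] with t ht
      have hrt : r < t⁻¹ := (lt_inv_comm₀ ht.1 hr0).1 ht.2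
      have hRr : R < t⁻¹ := by
        have := (le_max_left R ‖X‖).trans (le_max_left _ 0); linarith
      have hXr : ‖X‖ < t⁻¹ := by
        have := (le_max_right R ‖X‖).trans (le_max_left _ 0); linarith
      have h2 := h _ hRr
      have h3 := hFz ((t⁻¹ : ℝ) : ℂ) (by exact_mod_cast (inv_pos.2 ht.1).ne')
        (mem_resolventSet_of_norm_lt hX.isSelfAdjoint hXr)
      rw [map_resolvent_ofReal hφ hX.isSelfAdjoint, Complex.ofReal_inv, inv_inv] at h3
      set g := cauchyTransform φ X t⁻¹
      have htne : (t : ℂ) ≠ 0 := by exact_mod_cast ht.1.ne'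
      have h2C : ((t : ℂ)⁻¹) ^ 2 * g ^ 2 - (α * ((t : ℂ)⁻¹) ^ 2 + l * (t : ℂ)⁻¹ - β) * g
          + α * (t : ℂ)⁻¹ + k = 0 := by exact_mod_cast h2
      simp only [hΦ]
      rw [h3]
      field_simp at h2C ⊢
      linear_combination h2C
    have h2 : Filter.Tendsto (fun t : ℝ => (t : ℂ)) (nhdsWithin (0 : ℝ) (Set.Ioi 0))
        (nhdsWithin (0 : ℂ) {0}ᶜ) := by
      refine tendsto_nhdsWithin_iff.2 ⟨?_, ?_⟩
      · exact (Complex.continuous_ofReal.tendsto' 0 0 (by simp)).mono_left nhdsWithin_le_nhds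
      · filter_upwards [self_mem_nhdsWithin] with t (ht : 0 < t)
        simpa using ht.ne'
    exact h2.frequently h1
  have hzero := (hΦd.analyticOnNhd hWo).eqOn_zero_of_preconnected_of_frequently_eq_zero hWc hW0
    hfreq
  have hz0 : z ≠ 0 := by
    rintro rfl
    simp at hz
  have hzW : z⁻¹ ∈ W := by
    change 1 - (‖X‖ : ℂ) * z⁻¹ ∈ Complex.slitPlane
    have hn := Complex.normSq_pos.2 hz0
    rw [Complex.mem_slitPlane_iff]
    rcases hz with hz | hz
    · rcases (norm_nonneg X).eq_or_lt with h0 | h0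
      · left; simp [← h0]
      · right
        simp only [Complex.sub_im, Complex.one_im, Complex.im_ofReal_mul, Complex.inv_im]
        have := mul_ne_zero h0.ne' (div_ne_zero (neg_ne_zero.2 hz) hn.ne')
        simpa using this
    · left
      simp only [Complex.sub_re, Complex.one_re, Complex.re_ofReal_mul, Complex.inv_re]
      have h1 : z.re / Complex.normSq z < 0 := div_neg_of_neg_of_pos hz hn
      have := mul_nonpos_of_nonneg_of_nonpos (norm_nonneg X) h1.le
      linarith
  have hfin := hzero hzW
  simp only [hΦ, Pi.zero_apply] at hfin
  rw [hFz z hz0 (mem_resolventSet_of_im_ne_zero_or_re_neg hX hz)] at hfin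
  field_simp at hfin
  linear_combination hfin

theorem exists_roots_of_quadratic (hφ : IsFaithfulNormalTracialState φ)
    (hX : IsStrictlyPositive X) {α β l k R : ℝ} (hα : 0 < α) (hβ : 0 < β)
    (h : ∀ x, R < x → x ^ 2 * cauchyTransform φ X x ^ 2
      - (α * x ^ 2 + l * x - β) * cauchyTransform φ X x + α * x + k = 0) :
    ∃ a b : ℝ, 0 < a ∧ a < b ∧ ∀ x : ℝ, (α * x ^ 2 + l * x - β) ^ 2 - 4 * x ^ 2 * (α * x + k) =
      (α * x + β / √(a * b)) ^ 2 * ((x - a) * (x - b)) := by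
  have hres : ∀ x : ℝ, x ≤ 0 → (x : ℂ) ∈ resolventSet ℂ X := by
    intro x hx
    rcases hx.lt_or_eq with hx | rfl
    · exact mem_resolventSet_of_im_ne_zero_or_re_neg hX.nonneg (.inr (by simpa using hx))
    · rw [spectrum.mem_resolventSet_iff]
      simpa using hX.isUnit
  refine exists_roots_of_sq hα hβ (G := cauchyTransform φ X) ?_ ?_ ?_ ?_
  · exact fun x hx => (continuousAt_cauchyTransform hφ (hres x hx)).continuousWithinAt
  · intro x hx
    have h1 : IsStrictlyPositive (algebraMap ℝ A (-x) + X) :=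
      isStrictlyPositive_algebraMap_add hX.nonneg (by linarith)
    have h2 : resolvent X (x : ℂ) = -Ring.inverse (algebraMap ℝ A (-x) + X) := by
      have e : algebraMap ℝ A x - X = -(algebraMap ℝ A (-x) + X) := by rw [map_neg]; abel
      rw [resolvent_ofReal, e]
      refine inverse_eq_of_mul_eq_one h1.isUnit.neg ?_
      rw [neg_mul_neg, Ring.mul_inverse_cancel _ h1.isUnit]
    rw [cauchyTransform, h2, map_neg, Complex.neg_re, neg_lt_zero]
    exact hφ.re_pos h1.ringInverse
  · intro x hx
    have := quadratic_resolvent hφ hX.nonneg h (z := (x : ℂ)) (.inr (by simpa using hx))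
    rw [map_resolvent_ofReal hφ hX.isSelfAdjoint] at this
    have h1 : x ^ 2 * cauchyTransform φ X x ^ 2
      - (α * x ^ 2 + l * x - β) * cauchyTransform φ X x + α * x + k = 0 := by exact_mod_cast this
    linear_combination 4 * x ^ 2 * h1
  · intro ρ hρ h0
    set Gc : ℂ → ℂ := fun z => φ (resolvent X z) with hGc
    obtain ⟨G', hG'⟩ : ∃ G', HasDerivAt Gc G' ρ := by
      let φL : A →L[ℂ] ℂ := ⟨φ, hφ.continuous⟩
      exact ⟨_, φL.hasFDerivAt.comp_hasDerivAt ρ (spectrum.hasDerivAt_resolvent_const_left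
        (mem_resolventSet_of_im_ne_zero_or_re_neg hX.nonneg (.inl hρ)))⟩
    have hP : HasDerivAt (fun z : ℂ => α * z ^ 2 + l * z - β) (2 * α * ρ + l) ρ := by
      have := (((hasDerivAt_pow 2 ρ).const_mul (α : ℂ)).add
        ((hasDerivAt_id ρ).const_mul (l : ℂ))).sub_const (β : ℂ)
      refine this.congr_deriv ?_
      simp; ring
    have h2 : HasDerivAt (fun z : ℂ => 4 * z ^ 2 * (α * z + k)) (8 * ρ * (α * ρ + k)
        + 4 * ρ ^ 2 * α) ρ := by
      have := ((hasDerivAt_pow 2 ρ).const_mul 4).mul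
        (((hasDerivAt_id ρ).const_mul (α : ℂ)).add_const (k : ℂ))
      refine this.congr_deriv ?_
      simp only [id_eq, Nat.reduceSub, pow_one, Nat.cast_ofNat]
      ring
    have hQ := (hP.pow 2).sub h2
    have hHd := (((hasDerivAt_pow 2 ρ).const_mul (2 : ℂ)).mul hG').sub hP
    have hev : ∀ z : ℂ, z.im ≠ 0 → (2 * z ^ 2 * Gc z - (α * z ^ 2 + l * z - β)) ^ 2 =
        (α * z ^ 2 + l * z - β) ^ 2 - 4 * z ^ 2 * (α * z + k) := by
      intro z hz
      have := quadratic_resolvent hφ hX.nonneg h (.inl hz)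
      simp only [hGc]
      linear_combination 4 * z ^ 2 * this
    have hsq := hHd.pow 2
    have hev' : (fun z : ℂ => (α * z ^ 2 + l * z - β) ^ 2 - 4 * z ^ 2 * (α * z + k))
        =ᶠ[nhds ρ] fun z => (2 * z ^ 2 * Gc z - (α * z ^ 2 + l * z - β)) ^ 2 := by
      have : IsOpen {z : ℂ | z.im ≠ 0} := isOpen_ne_fun Complex.continuous_im continuous_const
      filter_upwards [this.mem_nhds hρ] with z hz
      exact (hev z hz).symm
    -- Near ρ the quartic is the square of this holomorphic function, so at a zero its derivative
    -- vanishes too.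
    have hHρ : 2 * ρ ^ 2 * Gc ρ - (α * ρ ^ 2 + l * ρ - β) = 0 := by
      have := hev ρ hρ
      rw [h0] at this
      exact pow_eq_zero_iff two_ne_zero |>.1 this
    have huniq := hQ.unique (hsq.congr_of_eventuallyEq hev')
    simp only [Pi.sub_apply, Pi.mul_apply] at huniq
    rw [hHρ] at huniq
    simp only [Nat.reduceSub, pow_one, Nat.cast_ofNat, mul_zero, zero_mul] at huniq
    linear_combination huniq

end CauchyTransform

/-! ### Semicircle integrals -/

theorem hasSum_pow_mul_sin {v : ℝ} (hv : |v| < 1) (θ : ℝ) :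
    HasSum (fun n : ℕ => v ^ n * Real.sin ((n + 1) * θ))
      (Real.sin θ / (1 - 2 * v * Real.cos θ + v ^ 2)) := by
  set w : ℂ := Complex.exp (θ * Complex.I) with hw
  have hwn : ‖w‖ = 1 := Complex.norm_exp_ofReal_mul_I θ
  have hlt : ‖(v : ℂ) * w‖ < 1 := by rwa [norm_mul, hwn, mul_one, Complex.norm_real]
  have h1 := ((hasSum_geometric_of_norm_lt_one hlt).mul_left w).mapL Complex.imCLM
  simp only [Complex.imCLM_apply] at h1
  have hwre : w.re = Real.cos θ := Complex.exp_ofReal_mul_I_re θ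
  have hwim : w.im = Real.sin θ := Complex.exp_ofReal_mul_I_im θ
  convert h1 using 1
  · funext n
    have : w * ((v : ℂ) * w) ^ n = ((v ^ n : ℝ) : ℂ) *
        Complex.exp ((((n + 1) * θ : ℝ) : ℂ) * Complex.I) := by
      rw [mul_pow, mul_left_comm, ← pow_succ', hw, ← Complex.exp_nat_mul]
      push_cast
      ring_nf
    rw [this, Complex.im_ofReal_mul, Complex.exp_ofReal_mul_I_im]
  · rw [← div_eq_mul_inv, Complex.div_im]
    have hn : Complex.normSq (1 - (v : ℂ) * w) = 1 - 2 * v * Real.cos θ + v ^ 2 := by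
      rw [Complex.normSq_apply]
      simp only [Complex.sub_re, Complex.one_re, Complex.re_ofReal_mul, Complex.sub_im,
        Complex.one_im, Complex.im_ofReal_mul, hwre, hwim]
      have := Real.sin_sq_add_cos_sq θ
      linear_combination v ^ 2 * this
    rw [hn, ← sub_div]
    simp only [Complex.sub_re, Complex.one_re, Complex.re_ofReal_mul, Complex.sub_im,
      Complex.one_im, Complex.im_ofReal_mul, hwre, hwim]
    ring

theorem integral_sin_mul_sin_succ (n : ℕ) :
    ∫ θ in (0 : ℝ)..Real.pi, Real.sin θ * Real.sin ((n + 1) * θ) =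
      if n = 0 then Real.pi / 2 else 0 := by
  have hcos : ∀ k : ℕ, k ≠ 0 → ∫ θ in (0 : ℝ)..Real.pi, Real.cos (k * θ) = 0 := by
    intro k hk
    have hk' : (k : ℝ) ≠ 0 := by exact_mod_cast hk
    rw [intervalIntegral.integral_comp_mul_left (fun x => Real.cos x) hk', integral_cos]
    simp [Real.sin_nat_mul_pi]
  have hprod : ∀ θ : ℝ, Real.sin θ * Real.sin ((n + 1) * θ) =
      (Real.cos (n * θ) - Real.cos (((n + 2 : ℕ) : ℝ) * θ)) / 2 := by
    intro θ
    have e1 : (n : ℝ) * θ = (n + 1) * θ - θ := by ring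
    have e2 : ((n + 2 : ℕ) : ℝ) * θ = (n + 1) * θ + θ := by push_cast; ring
    rw [e1, e2, Real.cos_sub, Real.cos_add]; ring
  simp only [hprod]
  rw [intervalIntegral.integral_div, intervalIntegral.integral_sub
    (Continuous.intervalIntegrable (by fun_prop) _ _)
    (Continuous.intervalIntegrable (by fun_prop) _ _), hcos (n + 2) (by omega)]
  split_ifs with h
  · subst h; simp
  · rw [hcos n h]; simp

/-- Expand in the series of vⁿ sin((n+1)θ) and integrate termwise against sin θ; orthogonality keeps
only n = 0. -/
theorem integral_sin_sq_div {v : ℝ} (hv : |v| < 1) :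
    ∫ θ in (0 : ℝ)..Real.pi, Real.sin θ ^ 2 / (1 - 2 * v * Real.cos θ + v ^ 2) = Real.pi / 2 := by
  have e : ∀ θ : ℝ, Real.sin θ ^ 2 / (1 - 2 * v * Real.cos θ + v ^ 2) =
      Real.sin θ * (Real.sin θ / (1 - 2 * v * Real.cos θ + v ^ 2)) := fun θ => by ring
  have e' : ∀ (n : ℕ) (θ : ℝ), Real.sin θ * (v ^ n * Real.sin ((n + 1) * θ)) =
      v ^ n * (Real.sin θ * Real.sin ((n + 1) * θ)) := fun n θ => by ring
  simp only [e]
  have h := intervalIntegral.hasSum_integral_of_dominated_convergence (μ := volume)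
    (a := 0) (b := Real.pi) (F := fun (n : ℕ) θ => Real.sin θ * (v ^ n * Real.sin ((n + 1) * θ)))
    (f := fun θ => Real.sin θ * (Real.sin θ / (1 - 2 * v * Real.cos θ + v ^ 2)))
    (fun n _ => |v| ^ n)
    (fun n => (Continuous.aestronglyMeasurable (by fun_prop)))
    (fun n => Filter.Eventually.of_forall fun θ _ => by
      rw [e', norm_mul, norm_pow, Real.norm_eq_abs, norm_mul]
      refine mul_le_of_le_one_right (by positivity) ?_
      exact mul_le_one₀ (Real.abs_sin_le_one _) (norm_nonneg _) (Real.abs_sin_le_one _))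
    (Filter.Eventually.of_forall fun θ _ => summable_geometric_of_lt_one (abs_nonneg v) hv)
    (by simp)
    (Filter.Eventually.of_forall fun θ _ => (hasSum_pow_mul_sin hv θ).mul_left (Real.sin θ))
  have h0 := hasSum_single (f := fun n : ℕ => ∫ θ in (0 : ℝ)..Real.pi,
    v ^ n * (Real.sin θ * Real.sin ((n + 1) * θ))) 0 (fun n hn => by
      rw [intervalIntegral.integral_const_mul, integral_sin_mul_sin_succ, if_neg hn, mul_zero])
  simp only [e'] at h
  rw [h.unique h0, intervalIntegral.integral_const_mul, integral_sin_mul_sin_succ]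
  simp

section Semicircle

variable {a b : ℝ}

theorem integral_eq_integral_cos (hab : a < b) {g : ℝ → ℝ} (hg : ContinuousOn g (Set.Icc a b)) :
    ∫ t in a..b, g t = ∫ θ in (0 : ℝ)..Real.pi,
      g ((a + b) / 2 + (b - a) / 2 * Real.cos θ) * ((b - a) / 2 * Real.sin θ) := by
  have hmaps : ∀ θ : ℝ, (a + b) / 2 + (b - a) / 2 * Real.cos θ ∈ Set.Icc a b := by
    intro θ
    have h1 := Real.cos_le_one θ
    have h2 := Real.neg_one_le_cos θ
    constructor <;> nlinarith
  have h := intervalIntegral.integral_comp_mul_deriv' (a := 0) (b := Real.pi)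
    (f := fun θ => (a + b) / 2 + (b - a) / 2 * Real.cos θ)
    (f' := fun θ => (b - a) / 2 * -Real.sin θ) (g := g)
    (fun θ _ => ((Real.hasDerivAt_cos θ).const_mul _).const_add _)
    (by fun_prop)
    (hg.mono (by rintro _ ⟨θ, _, rfl⟩; exact hmaps θ))
  have e1 : (a + b) / 2 + (b - a) / 2 * Real.cos 0 = b := by rw [Real.cos_zero]; ring
  have e2 : (a + b) / 2 + (b - a) / 2 * Real.cos Real.pi = a := by rw [Real.cos_pi]; ring
  simp only [e1, e2, Function.comp] at h
  rw [intervalIntegral.integral_symm, ← h, ← intervalIntegral.integral_neg]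
  refine intervalIntegral.integral_congr fun θ _ => ?_
  ring

theorem sqrt_eq_mul_sin (hab : a < b) {θ : ℝ} (hθ : θ ∈ Set.Icc 0 Real.pi) :
    √(((a + b) / 2 + (b - a) / 2 * Real.cos θ - a) * (b - ((a + b) / 2 + (b - a) / 2 * Real.cos θ)))
      = (b - a) / 2 * Real.sin θ := by
  have hs := Real.sin_nonneg_of_mem_Icc hθ
  rw [show ((a + b) / 2 + (b - a) / 2 * Real.cos θ - a) *
      (b - ((a + b) / 2 + (b - a) / 2 * Real.cos θ)) = ((b - a) / 2 * Real.sin θ) ^ 2 by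
    linear_combination (-((b - a) / 2) ^ 2) * Real.sin_sq_add_cos_sq θ]
  exact Real.sqrt_sq (mul_nonneg (by linarith) hs)

theorem integral_sqrt_mul (hab : a < b) :
    ∫ t in a..b, √((t - a) * (b - t)) = Real.pi * ((b - a) / 2) ^ 2 / 2 := by
  rw [integral_eq_integral_cos hab (by fun_prop)]
  have : ∀ θ ∈ Set.uIcc 0 Real.pi, √(((a + b) / 2 + (b - a) / 2 * Real.cos θ - a) *
      (b - ((a + b) / 2 + (b - a) / 2 * Real.cos θ))) * ((b - a) / 2 * Real.sin θ) =
      ((b - a) / 2) ^ 2 * Real.sin θ ^ 2 := by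
    intro θ hθ
    rw [Set.uIcc_of_le Real.pi_pos.le] at hθ
    rw [sqrt_eq_mul_sin hab hθ]; ring
  rw [intervalIntegral.integral_congr this, intervalIntegral.integral_const_mul, integral_sin_sq]
  simp
  ring

/-- Joukowski substitution: with t = (a+b)/2 + (b-a)/2·cos θ and z written through v, the
denominator z - t is a multiple of 1 - 2v cos θ + v². Positive v gives z > b; negative v gives z <
a, used at z = 0. -/
theorem integral_sqrt_div_sub (hab : a < b) {z v : ℝ} (hz : z ∉ Set.Icc a b) (hv : |v| < 1)
    (hv0 : v ≠ 0) (hzv : z - (a + b) / 2 = (b - a) / 2 * ((v + v⁻¹) / 2)) :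
    ∫ t in a..b, √((t - a) * (b - t)) / (z - t) = Real.pi * ((b - a) / 2 * v) := by
  have hne : ∀ t ∈ Set.Icc a b, z - t ≠ 0 := fun t ht h => hz (by
    rw [sub_eq_zero.1 h]; exact ht)
  rw [integral_eq_integral_cos hab (g := fun t => √((t - a) * (b - t)) / (z - t))
    (ContinuousOn.div (by fun_prop) (by fun_prop) hne)]
  have hr : (b - a) / 2 ≠ 0 := by
    have : 0 < (b - a) / 2 := by linarith
    exact this.ne'
  have : ∀ θ ∈ Set.uIcc 0 Real.pi, √(((a + b) / 2 + (b - a) / 2 * Real.cos θ - a) *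
      (b - ((a + b) / 2 + (b - a) / 2 * Real.cos θ))) /
        (z - ((a + b) / 2 + (b - a) / 2 * Real.cos θ)) * ((b - a) / 2 * Real.sin θ) =
      ((b - a) * v) * (Real.sin θ ^ 2 / (1 - 2 * v * Real.cos θ + v ^ 2)) := by
    intro θ hθ
    rw [Set.uIcc_of_le Real.pi_pos.le] at hθ
    rw [sqrt_eq_mul_sin hab hθ]
    have e : z - ((a + b) / 2 + (b - a) / 2 * Real.cos θ) =
        (b - a) / 2 * (1 - 2 * v * Real.cos θ + v ^ 2) / (2 * v) := by
      rw [← sub_sub, hzv]; field_simp; ring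
    rw [e]
    field_simp
  rw [intervalIntegral.integral_congr this, intervalIntegral.integral_const_mul,
    integral_sin_sq_div hv]
  ring

theorem integral_sqrt_div_sub_of_lt (hab : a < b) {z : ℝ} (hz : b < z) :
    ∫ t in a..b, √((t - a) * (b - t)) / (z - t) =
      Real.pi * (z - (a + b) / 2 - √((z - a) * (z - b))) := by
  have hr : 0 < (b - a) / 2 := by linarith
  have hT2 : √((z - a) * (z - b)) ^ 2 = (z - a) * (z - b) :=
    Real.sq_sqrt (mul_nonneg (by linarith) (by linarith))
  have hT1 : z - b < √((z - a) * (z - b)) := Real.lt_sqrt_of_sq_lt (by nlinarith)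
  have hT3 : √((z - a) * (z - b)) < z - (a + b) / 2 := by
    rw [Real.sqrt_lt' (by linarith)]; nlinarith
  set T := √((z - a) * (z - b))
  have hv0 : 0 < (z - (a + b) / 2 - T) / ((b - a) / 2) := div_pos (by linarith) hr
  have hv1 : (z - (a + b) / 2 - T) / ((b - a) / 2) < 1 := by
    rw [div_lt_one hr]; linarith
  have hne : z - (a + b) / 2 - T ≠ 0 := by linarith
  have hba : b - a ≠ 0 := by linarith
  rw [integral_sqrt_div_sub hab (v := (z - (a + b) / 2 - T) / ((b - a) / 2)) (fun h => by
    linarith [h.2]) (by rw [abs_of_pos hv0]; exact hv1) hv0.ne']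
  · field_simp
  · have hinv : ((z - (a + b) / 2 - T) / ((b - a) / 2))⁻¹ = (z - (a + b) / 2 + T) / ((b - a) / 2) := by
      rw [inv_div, div_eq_div_iff hne hr.ne']
      linear_combination hT2
    rw [hinv]
    field_simp
    ring

theorem sqrt_mul_lt_add_div_two (ha : 0 < a) (hab : a < b) :
    a < √(a * b) ∧ √(a * b) < (a + b) / 2 := by
  refine ⟨Real.lt_sqrt_of_sq_lt (by nlinarith), ?_⟩
  rw [Real.sqrt_lt' (by linarith)]
  nlinarith [sq_pos_of_pos (sub_pos.2 hab)]

theorem integral_sqrt_div (ha : 0 < a) (hab : a < b) :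
    ∫ t in a..b, √((t - a) * (b - t)) / t = Real.pi * ((a + b) / 2 - √(a * b)) := by
  have hr : 0 < (b - a) / 2 := by linarith
  obtain ⟨hs1, hs2⟩ := sqrt_mul_lt_add_div_two ha hab
  have hsq : √(a * b) ^ 2 = a * b := Real.sq_sqrt (mul_nonneg ha.le (by linarith))
  set s := √(a * b)
  have hne : (a + b) / 2 - s ≠ 0 := by linarith
  have hba : b - a ≠ 0 := by linarith
  have hv0 : 0 < ((a + b) / 2 - s) / ((b - a) / 2) := div_pos (by linarith) hr
  have hv1 : ((a + b) / 2 - s) / ((b - a) / 2) < 1 := by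
    rw [div_lt_one hr]; linarith
  have h := integral_sqrt_div_sub hab (z := 0) (v := -(((a + b) / 2 - s) / ((b - a) / 2)))
    (fun h => by linarith [h.1]) (by rw [abs_neg, abs_of_pos hv0]; exact hv1)
    (neg_ne_zero.2 hv0.ne') (by
      have hinv : (((a + b) / 2 - s) / ((b - a) / 2))⁻¹ = ((a + b) / 2 + s) / ((b - a) / 2) := by
        rw [inv_div, div_eq_div_iff hne hr.ne']
        linear_combination hsq
      rw [inv_neg, hinv]
      field_simp
      ring)
  simp only [zero_sub, div_neg] at h
  rw [intervalIntegral.integral_neg] at h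
  have e : (b - a) / 2 * -(((a + b) / 2 - s) / ((b - a) / 2)) = -((a + b) / 2 - s) := by
    field_simp
  rw [e] at h
  linarith

/-- With q = (t - a)(b - t), the function q^{3/2}/t vanishes at both ends, and its derivative
combines √q, √q/t and √q/t², whose first two integrals are known. -/
theorem integral_sqrt_div_sq (ha : 0 < a) (hab : a < b) :
    ∫ t in a..b, √((t - a) * (b - t)) / t ^ 2 = Real.pi * ((a + b) / 2 / √(a * b) - 1) := by
  have hab0 : 0 < a * b := mul_pos ha (ha.trans hab)
  have hne : ∀ t ∈ Set.uIcc a b, t ≠ 0 := fun t ht => by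
    rw [Set.uIcc_of_le hab.le] at ht; linarith [ht.1]
  have hI0 : IntervalIntegrable (fun t => √((t - a) * (b - t))) volume a b :=
    Continuous.intervalIntegrable (by fun_prop) _ _
  have hI1 : IntervalIntegrable (fun t => √((t - a) * (b - t)) / t) volume a b :=
    ContinuousOn.intervalIntegrable (ContinuousOn.div (by fun_prop) (by fun_prop) hne)
  have hI2 : IntervalIntegrable (fun t => √((t - a) * (b - t)) / t ^ 2) volume a b :=
    ContinuousOn.intervalIntegrable (ContinuousOn.div (by fun_prop) (by fun_prop)
      fun t ht => pow_ne_zero 2 (hne t ht))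
  have hF := intervalIntegral.integral_eq_sub_of_hasDerivAt_of_le hab.le
    (f := fun t => (t - a) * (b - t) * √((t - a) * (b - t)) / t)
    (f' := fun t => -2 * √((t - a) * (b - t)) + (a + b) / 2 * (√((t - a) * (b - t)) / t)
      + a * b * (√((t - a) * (b - t)) / t ^ 2))
    (by
      rw [← Set.uIcc_of_le hab.le]
      exact ContinuousOn.div (by fun_prop) (by fun_prop) hne)
    (fun t ht => by
      have hq : 0 < (t - a) * (b - t) := mul_pos (by linarith [ht.1]) (by linarith [ht.2])
      have hq' : HasDerivAt (fun t : ℝ => (t - a) * (b - t)) (a + b - 2 * t) t := by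
        have := ((hasDerivAt_id t).sub_const a).mul ((hasDerivAt_id t).const_sub b)
        refine this.congr_deriv ?_
        simp; ring
      have hsq := Real.sq_sqrt hq.le
      have hs0 := (Real.sqrt_pos.2 hq).ne'
      have ht0 : t ≠ 0 := by linarith [ht.1]
      refine ((hq'.mul (hq'.sqrt hq.ne')).div (hasDerivAt_id t) ht0).congr_deriv ?_
      simp only [id, Pi.mul_apply]
      set w := √((t - a) * (b - t))
      have hw : (t - a) * (b - t) * (( a + b - 2 * t) / (2 * w)) = w * (a + b - 2 * t) / 2 := by
        rw [← hsq]; field_simp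
      rw [hw]
      field_simp
      ring)
    (((hI0.const_mul _).add (hI1.const_mul _)).add (hI2.const_mul _))
  rw [intervalIntegral.integral_add ((hI0.const_mul _).add (hI1.const_mul _)) (hI2.const_mul _),
    intervalIntegral.integral_add (hI0.const_mul _) (hI1.const_mul _),
    intervalIntegral.integral_const_mul, intervalIntegral.integral_const_mul,
    intervalIntegral.integral_const_mul, integral_sqrt_mul hab, integral_sqrt_div ha hab] at hF
  simp only [sub_self, zero_mul, mul_zero, zero_div] at hF
  have hs0 : 0 < √(a * b) := Real.sqrt_pos.2 hab0
  have hsq : √(a * b) ^ 2 = a * b := Real.sq_sqrt hab0.le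
  set s := √(a * b)
  refine mul_left_cancel₀ hab0.ne' ?_
  have e : a * b * (Real.pi * ((a + b) / 2 / s - 1)) = Real.pi * ((a + b) / 2 * s - a * b) := by
    rw [← hsq]; field_simp
  rw [e]
  linear_combination hF

end Semicircle

/-! ### Cauchy transform and moments of the density -/

section Density

/-- The common form of the free Poisson and free generalized inverse Gaussian densities. -/
def gigDensity (a b α η x : ℝ) : ℝ :=
  1 / (2 * Real.pi) * √((x - a) * (b - x)) * (α / x + η / x ^ 2)

variable {a b α η : ℝ}

theorem continuousOn_gigDensity (ha : 0 < a) :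
    ContinuousOn (gigDensity a b α η) (Set.Icc a b) := by
  have hne : ∀ t ∈ Set.Icc a b, t ≠ 0 := fun t ht => by linarith [ht.1]
  refine ContinuousOn.mul (by fun_prop) (ContinuousOn.add ?_ ?_)
  · exact ContinuousOn.div (by fun_prop) (by fun_prop) hne
  · exact ContinuousOn.div (by fun_prop) (by fun_prop) fun t ht => pow_ne_zero 2 (hne t ht)

theorem gigDensity_nonneg (ha : 0 < a) (hα : 0 ≤ α) (hη : 0 ≤ η) {x : ℝ} (hx : a ≤ x) :
    0 ≤ gigDensity a b α η x := by
  have : 0 < x := ha.trans_le hx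
  have := Real.pi_pos
  unfold gigDensity
  positivity

/-- Partial fractions in t reduce the integrand to √q/(z - t), √q/t and √q/t², where q = (t - a)(b -
t). -/
theorem integral_gigDensity_div_sub (ha : 0 < a) (hab : a < b) {z : ℝ} (hz : b < z) :
    2 * z ^ 2 * ∫ t in a..b, gigDensity a b α η t / (z - t) =
      α * z ^ 2 + z * (η * ((a + b) / 2) / √(a * b) - α * √(a * b)) - η * √(a * b)
        - (α * z + η) * √((z - a) * (z - b)) := by
  have hz0 : z ≠ 0 := by linarith
  have hpi := Real.pi_pos.ne'
  have hmem : ∀ t ∈ Set.uIcc a b, t ≠ 0 ∧ z - t ≠ 0 := fun t ht => by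
    rw [Set.uIcc_of_le hab.le] at ht
    exact ⟨by linarith [ht.1], by linarith [ht.2]⟩
  have hI0 : IntervalIntegrable (fun t => √((t - a) * (b - t)) / (z - t)) volume a b :=
    ContinuousOn.intervalIntegrable (ContinuousOn.div (by fun_prop) (by fun_prop)
      fun t ht => (hmem t ht).2)
  have hI1 : IntervalIntegrable (fun t => √((t - a) * (b - t)) / t) volume a b :=
    ContinuousOn.intervalIntegrable (ContinuousOn.div (by fun_prop) (by fun_prop)
      fun t ht => (hmem t ht).1)
  have hI2 : IntervalIntegrable (fun t => √((t - a) * (b - t)) / t ^ 2) volume a b :=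
    ContinuousOn.intervalIntegrable (ContinuousOn.div (by fun_prop) (by fun_prop)
      fun t ht => pow_ne_zero 2 (hmem t ht).1)
  have hcongr : ∀ t ∈ Set.uIcc a b, gigDensity a b α η t / (z - t) =
      (α * z + η) / (2 * Real.pi * z ^ 2) * (√((t - a) * (b - t)) / (z - t))
      + (α * z + η) / (2 * Real.pi * z ^ 2) * (√((t - a) * (b - t)) / t)
      + η / (2 * Real.pi * z) * (√((t - a) * (b - t)) / t ^ 2) := by
    intro t ht
    obtain ⟨h1, h2⟩ := hmem t ht
    unfold gigDensity
    field_simp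
    ring
  rw [intervalIntegral.integral_congr hcongr,
    intervalIntegral.integral_add ((hI0.const_mul _).add (hI1.const_mul _)) (hI2.const_mul _),
    intervalIntegral.integral_add (hI0.const_mul _) (hI1.const_mul _),
    intervalIntegral.integral_const_mul, intervalIntegral.integral_const_mul,
    intervalIntegral.integral_const_mul, integral_sqrt_div_sub_of_lt hab hz,
    integral_sqrt_div ha hab, integral_sqrt_div_sq ha hab]
  have hs0 : √(a * b) ≠ 0 := (Real.sqrt_pos.2 (mul_pos ha (ha.trans hab))).ne'
  field_simp
  ring

theorem hasSum_gigDensity_moments (ha : 0 < a) (hab : a < b) (hα : 0 ≤ α) (hη : 0 ≤ η) {z : ℝ}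
    (hz : b < z) :
    HasSum (fun n => (∫ t in a..b, t ^ n * gigDensity a b α η t) * z⁻¹ ^ n)
      (z * ∫ t in a..b, gigDensity a b α η t / (z - t)) := by
  have hz0 : 0 < z := by linarith
  have hcont : ContinuousOn (gigDensity a b α η) (Set.uIcc a b) := by
    rw [Set.uIcc_of_le hab.le]; exact continuousOn_gigDensity ha
  have hr1 : b / z < 1 := (div_lt_one hz0).2 hz
  have hr0 : 0 ≤ b / z := div_nonneg (by linarith) hz0.le
  have hIoc : ∀ t ∈ Set.uIoc a b, a < t ∧ t ≤ b := fun t ht => by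
    rwa [Set.uIoc_of_le hab.le] at ht
  have h := intervalIntegral.hasSum_integral_of_dominated_convergence (μ := volume)
    (a := a) (b := b) (F := fun (n : ℕ) t => gigDensity a b α η t * (t / z) ^ n)
    (f := fun t => gigDensity a b α η t * (1 - t / z)⁻¹)
    (fun n t => gigDensity a b α η t * (b / z) ^ n)
    (fun n => ((hcont.mono Set.uIoc_subset_uIcc).mul (by fun_prop)).aestronglyMeasurable
      measurableSet_uIoc)
    (fun n => Filter.Eventually.of_forall fun t ht => by
      obtain ⟨h1, h2⟩ := hIoc t ht
      have ht0 : 0 ≤ t / z := div_nonneg (by linarith) hz0.le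
      have hd := gigDensity_nonneg (b := b) ha hα hη h1.le
      rw [Real.norm_of_nonneg (mul_nonneg hd (pow_nonneg ht0 n))]
      gcongr)
    (Filter.Eventually.of_forall fun t _ =>
      (summable_geometric_of_lt_one hr0 hr1).mul_left _)
    (by
      simp only [tsum_mul_left]
      exact (hcont.intervalIntegrable).mul_const _)
    (Filter.Eventually.of_forall fun t ht => by
      obtain ⟨h1, h2⟩ := hIoc t ht
      have ht0 : 0 ≤ t / z := div_nonneg (by linarith) hz0.le
      exact (hasSum_geometric_of_lt_one ht0 ((div_lt_one hz0).2 (by linarith))).mul_left _)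
  have e1 : ∀ n : ℕ, ∫ t in a..b, gigDensity a b α η t * (t / z) ^ n =
      (∫ t in a..b, t ^ n * gigDensity a b α η t) * z⁻¹ ^ n := by
    intro n
    rw [← intervalIntegral.integral_mul_const]
    refine intervalIntegral.integral_congr fun t _ => ?_
    simp only [div_eq_mul_inv, mul_pow]; ring
  have e2 : ∫ t in a..b, gigDensity a b α η t * (1 - t / z)⁻¹ =
      z * ∫ t in a..b, gigDensity a b α η t / (z - t) := by
    rw [← intervalIntegral.integral_const_mul]
    refine intervalIntegral.integral_congr fun t ht => ?_
    rw [Set.uIcc_of_le hab.le] at ht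
    have : z - t ≠ 0 := by linarith [ht.2]
    have h1 : (1 - t / z)⁻¹ = z / (z - t) := by
      rw [one_sub_div hz0.ne', inv_div]
    simp only [h1]
    ring
  simp only [e1, e2] at h
  exact h

end Density

/-! ### Identifying a distribution from its quadratic equation -/

section Distribution

variable {A : Type*} [CStarAlgebra A] [PartialOrder A] [StarOrderedRing A] {φ : A →ₗ[ℂ] ℂ}
  {X : A}

theorem hasDistribution_of_quadratic (hφ : IsFaithfulNormalTracialState φ) (hX : 0 ≤ X)
    {a b α η β l k R : ℝ} (ha : 0 < a) (hab : a < b) (hα : 0 < α) (hη : 0 ≤ η)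
    (hβ : β = η * √(a * b)) (hl : l = η * ((a + b) / 2) / √(a * b) - α * √(a * b))
    (hfac : ∀ x : ℝ, (α * x ^ 2 + l * x - β) ^ 2 - 4 * x ^ 2 * (α * x + k) =
      (α * x + η) ^ 2 * ((x - a) * (x - b)))
    (h : ∀ x, R < x → x ^ 2 * cauchyTransform φ X x ^ 2
      - (α * x ^ 2 + l * x - β) * cauchyTransform φ X x + α * x + k = 0) :
    HasDistribution φ X ((volume.restrict (Set.Icc a b)).withDensity
      fun x => ENNReal.ofReal (gigDensity a b α η x)) := by
  have hN := norm_nonneg X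
  -- Beyond R the quadratic holds, and beyond b the integral formula. The term 2‖X‖ gives xG(x) ≤ 2,
  -- and the fraction then makes αx² + lx - β - 2x²G nonnegative, which selects the branch of the
  -- square root.
  set R' := |R| + 2 * ‖X‖ + b + (4 + |l| + |β|) / α + 1 with hR'
  have hq : 0 ≤ (4 + |l| + |β|) / α := by positivity
  have hRa := le_abs_self R
  have hR0 := abs_nonneg R
  have hG : ∀ x, R' < x →
      cauchyTransform φ X x = ∫ t in a..b, gigDensity a b α η t / (x - t) := by
    intro x hx
    have hxb : b < x := by linarith
    have hx0 : 0 < x := by linarith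
    have hx1 : 1 < x := by linarith
    have h1 := integral_gigDensity_div_sub (α := α) (η := η) ha hab hxb
    rw [← hl, ← hβ] at h1
    have h2 := h x (by linarith)
    have h3 := cauchyTransform_le_inv hφ hX (x := x) (by linarith)
    have h4 : cauchyTransform φ X x * x ≤ 2 := by
      have h5 : (x - ‖X‖)⁻¹ ≤ 2 / x := by
        rw [inv_le_comm₀ (by linarith) (by positivity), inv_div]
        linarith
      have := h3.trans h5
      rwa [le_div_iff₀ hx0] at this
    set g := cauchyTransform φ X x
    have hT0 : 0 ≤ √((x - a) * (x - b)) := Real.sqrt_nonneg _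
    have hT2 : √((x - a) * (x - b)) ^ 2 = (x - a) * (x - b) :=
      Real.sq_sqrt (mul_nonneg (by linarith) (by linarith))
    set T := √((x - a) * (x - b))
    have hsq : ((α * x ^ 2 + l * x - β) - 2 * x ^ 2 * g) ^ 2 = ((α * x + η) * T) ^ 2 := by
      rw [mul_pow, hT2, ← hfac x]
      linear_combination 4 * x ^ 2 * h2
    have hpos : 0 ≤ (α * x ^ 2 + l * x - β) - 2 * x ^ 2 * g := by
      have e1 : 4 + |l| + |β| ≤ α * x := by
        have : (4 + |l| + |β|) / α ≤ x := by linarith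
        rwa [div_le_iff₀' hα] at this
      have e2 := neg_abs_le l
      have e3 := le_abs_self β
      have e4 := mul_le_mul_of_nonneg_right e1 hx0.le
      have e5 := mul_le_mul_of_nonneg_left h4 hx0.le
      have e6 : |β| * 1 ≤ |β| * x := mul_le_mul_of_nonneg_left hx1.le (abs_nonneg β)
      have e7 := mul_le_mul_of_nonneg_right e2 hx0.le
      linarith
    have hpos' : 0 ≤ (α * x + η) * T := by positivity
    have h6 := (pow_left_inj₀ hpos hpos' two_ne_zero).1 hsq
    have hx2 : 2 * x ^ 2 ≠ 0 := by positivity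
    refine mul_left_cancel₀ hx2 ?_
    linear_combination -h1 - h6
  have hmom : (fun n => (φ (X ^ n)).re) = fun n => ∫ t in a..b, t ^ n * gigDensity a b α η t := by
    refine eq_of_hasSum_inv_pow (R := R') (F := fun x => x * cauchyTransform φ X x)
      (fun x hx => hasSum_moments hφ hX.isSelfAdjoint (by linarith)) (fun x hx => ?_)
    rw [hG x hx]
    exact hasSum_gigDensity_moments ha hab hα.le hη (by linarith)
  have hnn : ∀ᵐ t ∂volume.restrict (Set.Icc a b), 0 ≤ gigDensity a b α η t := by
    filter_upwards [ae_restrict_mem measurableSet_Icc] with t ht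
    exact gigDensity_nonneg ha hα.le hη ht.1
  have hmeas : AEMeasurable (fun t => ENNReal.ofReal (gigDensity a b α η t))
      (volume.restrict (Set.Icc a b)) :=
    ((continuousOn_gigDensity ha).aemeasurable measurableSet_Icc).ennreal_ofReal
  have hint : IntegrableOn (gigDensity a b α η) (Set.Icc a b) :=
    (continuousOn_gigDensity ha).integrableOn_Icc
  have hset : ∀ n : ℕ, ∫ t in Set.Icc a b, t ^ n * gigDensity a b α η t = (φ (X ^ n)).re := by
    intro n
    rw [congrFun hmom n, integral_Icc_eq_integral_Ioc, intervalIntegral.integral_of_le hab.le]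
  refine hasDistribution_of_moments hφ hX.isSelfAdjoint ⟨?_⟩ ⟨Set.Icc a b, isCompact_Icc, ?_⟩ ?_
  · rw [withDensity_apply _ MeasurableSet.univ, Measure.restrict_univ,
      ← ofReal_integral_eq_lintegral_ofReal hint hnn]
    have := hset 0
    simp only [pow_zero, one_mul, hφ.map_one, Complex.one_re] at this
    rw [this, ENNReal.ofReal_one]
  · refine withDensity_absolutelyContinuous _ _ ?_
    rw [Measure.restrict_apply measurableSet_Icc.compl, Set.compl_inter_self, measure_empty]
  · intro n
    rw [integral_withDensity_eq_integral_toReal_smul₀ hmeas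
      (Filter.Eventually.of_forall fun _ => ENNReal.ofReal_lt_top), ← hset n]
    refine integral_congr_ae ?_
    filter_upwards [hnn] with t ht
    rw [ENNReal.toReal_ofReal ht, smul_eq_mul, mul_comm]

theorem freePoisson_eq_withDensity {lam α : ℝ} (hlam : 1 < lam) (hα : 0 < α) :
    freePoisson lam (1 / α) =
      (volume.restrict (Set.Icc (1 / α * (1 - √lam) ^ 2) (1 / α * (1 + √lam) ^ 2))).withDensity
        fun x => ENNReal.ofReal (gigDensity (1 / α * (1 - √lam) ^ 2) (1 / α * (1 + √lam) ^ 2)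
          α 0 x) := by
  have hs : √lam ^ 2 = lam := Real.sq_sqrt (by linarith)
  rw [freePoisson, max_eq_left (by linarith), ENNReal.ofReal_zero, zero_smul, zero_add,
    Measure.restrict_congr_set Ioo_ae_eq_Icc]
  congr 1
  funext x
  congr 1
  have e : 4 * lam * (1 / α) ^ 2 - (x - 1 / α * (1 + lam)) ^ 2 =
      (x - 1 / α * (1 - √lam) ^ 2) * (1 / α * (1 + √lam) ^ 2 - x) := by
    linear_combination ((1 / α) ^ 2 * (√lam ^ 2 + lam + 2) * (-1) + 2 * (1 / α) * x
      + 4 * (1 / α) ^ 2) * (-hs)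
  rw [gigDensity, e, zero_div, add_zero]
  generalize √((x - 1 / α * (1 - √lam) ^ 2) * (1 / α * (1 + √lam) ^ 2 - x)) = w
  -- At x = 0 both densities are 0 by the convention for division by zero.
  rcases eq_or_ne x 0 with rfl | hx
  · simp
  · field_simp

end Distribution

/-! ### The laws of Y and X -/

section Characterization

variable {A : Type*} [CStarAlgebra A] [PartialOrder A] [StarOrderedRing A] {φ : A →ₗ[ℂ] ℂ}
  {X Y : A} {N : Subalgebra ℂ A} {c d : ℝ}

theorem ConstantRegressions.hasDistribution_freePoisson (h : ConstantRegressions φ X Y N c d)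
    (hφ : IsFaithfulNormalTracialState φ) (hX : IsStrictlyPositive X) (hY : IsStrictlyPositive Y)
    (hfree : Free φ X Y) (hcd : 1 < c * d) {lam α : ℝ} (hlam : lam = c * d / (c * d - 1))
    (hα : α = (φ (Ring.inverse Y)).re / (c * d - 1)) :
    HasDistribution φ Y (freePoisson lam (1 / α)) := by
  have he : 0 < c * d - 1 := by linarith
  have hδ0 := hφ.re_pos hY.ringInverse
  have hα0 : 0 < α := by rw [hα]; positivity
  have hlame : lam = 1 + 1 / (c * d - 1) := by rw [hlam]; field_simp; ring
  have hlam1 : 1 < lam := by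
    have : 0 < 1 / (c * d - 1) := by positivity
    linarith
  have hs2 : √lam ^ 2 = lam := Real.sq_sqrt (by linarith)
  have hs1 : 1 < √lam := Real.lt_sqrt_of_sq_lt (by linarith)
  rw [freePoisson_eq_withDensity hlam1 hα0]
  have hs : √(1 / α * (1 - √lam) ^ 2 * (1 / α * (1 + √lam) ^ 2)) = (lam - 1) / α := by
    rw [show 1 / α * (1 - √lam) ^ 2 * (1 / α * (1 + √lam) ^ 2) =
      ((√lam ^ 2 - 1) / α) ^ 2 by ring, hs2]
    exact Real.sqrt_sq (div_nonneg (by linarith) hα0.le)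
  refine hasDistribution_of_quadratic hφ hY.nonneg (l := 1 - lam) (β := 0) (k := 0)
    (R := 8 * (‖Y‖ + ‖X‖)) ?_ ?_ hα0 le_rfl (by ring) ?_ ?_ ?_
  · have : 1 - √lam ≠ 0 := by linarith
    positivity
  · refine mul_lt_mul_of_pos_left ?_ (by positivity)
    linarith
  · rw [hs, zero_mul, zero_div]; field_simp; ring
  · intro x
    have hαi : α * (1 / α) = 1 := by field_simp
    generalize 1 / α = γ at hαi
    linear_combination (2 * α * x ^ 3 * (1 + √lam ^ 2)
      - x ^ 2 * (√lam ^ 2 - 1) ^ 2 * (α * γ + 1)) * hαi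
      + (2 * α * x ^ 3 + 2 * x ^ 2 - x ^ 2 * (√lam ^ 2 + lam)) * hs2
  · intro y hy
    have hq := h.quadratic_right hφ hX hY hfree hy
    rw [hlame, hα]
    field_simp
    linear_combination (-y) * hq

theorem gig_equations_of_factorization {a b α β l k : ℝ} (ha : 0 < a) (hab : a < b) (hα : 0 < α)
    (hβ : 0 < β) (hfac : ∀ x : ℝ, (α * x ^ 2 + l * x - β) ^ 2 - 4 * x ^ 2 * (α * x + k) =
      (α * x + β / √(a * b)) ^ 2 * ((x - a) * (x - b))) :
    l + α * √(a * b) - β * ((a + b) / (2 * (a * b))) = 0 ∧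
      2 - l + β / √(a * b) - α * ((a + b) / 2) = 0 := by
  have hab0 : 0 < a * b := mul_pos ha (ha.trans hab)
  have hs0 : 0 < √(a * b) := Real.sqrt_pos.2 hab0
  have hs2 : √(a * b) ^ 2 = a * b := Real.sq_sqrt hab0.le
  obtain ⟨η, hη⟩ : ∃ η, η = β / √(a * b) := ⟨_, rfl⟩
  have hβη : β = η * √(a * b) := by rw [hη]; field_simp
  have hη0 : 0 < η := by rw [hη]; positivity
  rw [← hη] at hfac ⊢
  have f1 := hfac 1
  have f2 := hfac (-1)
  have f3 := hfac 2
  have f4 := hfac (-2)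
  -- Values at ±1 and ±2 isolate the odd coefficients: `hc3` is that of x³, `hc1` that of x.
  have hc3 : α * (2 - l + η - α * ((a + b) / 2)) = 0 := by
    linear_combination (1 / 12 : ℝ) * (f1 - f2) - (1 / 24 : ℝ) * (f3 - f4)
  have hc1 : -2 * l * β = 2 * α * η * (a * b) - η ^ 2 * (a + b) := by
    linear_combination (2 / 3 : ℝ) * (f1 - f2) - (1 / 12 : ℝ) * (f3 - f4)
  refine ⟨?_, (mul_eq_zero.1 hc3).resolve_left hα.ne'⟩
  generalize √(a * b) = s at *
  rw [← hs2] at hc1 ⊢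
  subst hβη
  have h1 : 2 * η * s * (l + α * s - η * (a + b) / (2 * s)) = 0 := by
    field_simp
    linear_combination -hc1
  have h2 := (mul_eq_zero.1 h1).resolve_left (by positivity)
  rw [← h2]
  field_simp

theorem ConstantRegressions.exists_isFreeGIG (h : ConstantRegressions φ X Y N c d)
    (hφ : IsFaithfulNormalTracialState φ) (hX : IsStrictlyPositive X) (hY : IsStrictlyPositive Y)
    (hfree : Free φ X Y) (hcd : 1 < c * d) {lam α β : ℝ} (hlam : lam = c * d / (c * d - 1))
    (hα : α = (φ (Ring.inverse Y)).re / (c * d - 1)) (hβ : β = d / (c * d - 1)) :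
    ∃ μ : Measure ℝ, IsFreeGIG μ (-lam) α β ∧ HasDistribution φ X μ := by
  have he : 0 < c * d - 1 := by linarith
  have hδ0 := hφ.re_pos hY.ringInverse
  have hd0 := h.pos hφ hX hY
  have hα0 : 0 < α := by rw [hα]; positivity
  have hβ0 : 0 < β := by rw [hβ]; positivity
  have hquad : ∀ x, 8 * (‖X‖ + ‖Y‖) < x → x ^ 2 * cauchyTransform φ X x ^ 2
      - (α * x ^ 2 + (1 + lam) * x - β) * cauchyTransform φ X x + α * x
      + β * (φ (Ring.inverse X)).re = 0 := by
    intro x hx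
    have hq := h.quadratic_left hφ hX hY hfree hx
    rw [hlam, hα, hβ]
    field_simp
    linear_combination -hq
  obtain ⟨a, b, ha, hab, hfac⟩ := exists_roots_of_quadratic hφ hX hα0 hβ0 hquad
  obtain ⟨g1, g2⟩ := gig_equations_of_factorization ha hab hα0 hβ0 hfac
  have hab0 : 0 < a * b := mul_pos ha (ha.trans hab)
  have hs0 : 0 < √(a * b) := Real.sqrt_pos.2 hab0
  have hs2 : √(a * b) ^ 2 = a * b := Real.sq_sqrt hab0.le
  refine ⟨_, ⟨hα0, hβ0, a, b, ha, hab, by linarith, by linarith, rfl⟩, ?_⟩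
  have hdens : ∀ x, 1 / (2 * Real.pi) * √((x - a) * (b - x)) * (α / x + β / (√(a * b) * x ^ 2)) =
      gigDensity a b α (β / √(a * b)) x := fun x => by rw [gigDensity, div_div]
  simp only [hdens]
  refine hasDistribution_of_quadratic hφ hX.nonneg ha hab hα0 (by positivity) (by field_simp) ?_
    hfac hquad
  have : β * ((a + b) / (2 * (a * b))) = β / √(a * b) * ((a + b) / 2) / √(a * b) := by
    generalize √(a * b) = s at hs0 hs2
    rw [← hs2]; field_simp
  linarith

end Characterization

/-! ### Transfer to the conditional expectation -/

section VonNeumann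

variable {H : Type*} [NormedAddCommGroup H] [InnerProductSpace ℂ H] [CompleteSpace H]
  {M : VonNeumannAlgebra H}

theorem coe_inverse_mem {N : VonNeumannAlgebra H} {a : M.toStarSubalgebra}
    (ha : (a : H →L[ℂ] H) ∈ N) (hu : IsUnit a) :
    ((Ring.inverse a : M.toStarSubalgebra) : H →L[ℂ] H) ∈ N := by
  refine N.mem_of_forall_commute fun R hR => ?_
  have hc : Commute (a : H →L[ℂ] H) R := VonNeumannAlgebra.mem_commutant_iff.1 hR _ ha
  obtain ⟨u, rfl⟩ := hu
  rw [Ring.inverse_unit]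
  exact Commute.units_inv_left
    (u := Units.map (M.toStarSubalgebra.subtype : M.toStarSubalgebra →* (H →L[ℂ] H)) u) hc

theorem self_mem_generatedBy (T : H →L[ℂ] H) : T ∈ generatedBy T :=
  StarAlgebra.adjoin_le_centralizer_centralizer ℂ {T}
    (StarAlgebra.self_mem_adjoin_singleton ℂ T)

theorem IsCondExp.map_mul {φ : M.toStarSubalgebra →ₗ[ℂ] ℂ} {N : VonNeumannAlgebra H}
    {E : M.toStarSubalgebra →ₗ[ℂ] M.toStarSubalgebra} (hE : IsCondExp φ N E)
    {V T : M.toStarSubalgebra} {r : ℂ} (hV : E V = r • 1) (hT : (T : H →L[ℂ] H) ∈ N) :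
    φ (V * T) = r * φ T := by
  have h := hE.bimodule 1 V T (one_mem N) hT
  rw [one_mul, one_mul, hV, smul_mul_assoc, one_mul] at h
  rw [← hE.preserves, h, map_smul, smul_eq_mul]

end VonNeumann

end FreeMY

end

theorem theorem4p1 {H : Type*} [NormedAddCommGroup H] [InnerProductSpace ℂ H] [CompleteSpace H]
    (M : VonNeumannAlgebra H) (φ : M.toStarSubalgebra →ₗ[ℂ] ℂ)
    (hφ : FreeMY.IsFaithfulNormalTracialState φ)
    (X Y U V : M.toStarSubalgebra)
    (hX : IsStrictlyPositive X) (hY : IsStrictlyPositive Y)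
    (hfree : FreeMY.Free φ X Y)
    (hXnd : FreeMY.NonDegenerate φ X) (hYnd : FreeMY.NonDegenerate φ Y)
    (hU : U = Ring.inverse (X + Y)) (hV : V = Ring.inverse X - Ring.inverse (X + Y))
    (E : M.toStarSubalgebra →ₗ[ℂ] M.toStarSubalgebra)
    (hE : FreeMY.IsCondExp φ (FreeMY.generatedBy (U : H →L[ℂ] H)) E)
    (c d : ℝ)
    (hc : E V = (c : ℂ) • (1 : M.toStarSubalgebra))
    (hd : E (Ring.inverse V) = (d : ℂ) • (1 : M.toStarSubalgebra)) :
    1 < c * d ∧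
    ∃ δ₀ lam α β : ℝ, 0 < δ₀ ∧ φ (Ring.inverse Y) = (δ₀ : ℂ) ∧
      lam = c * d / (c * d - 1) ∧ α = δ₀ / (c * d - 1) ∧ β = d / (c * d - 1) ∧
      FreeMY.HasDistribution φ Y (FreeMY.freePoisson lam (1 / α)) ∧
      ∃ μ : MeasureTheory.Measure ℝ, FreeMY.IsFreeGIG μ (-lam) α β ∧
        FreeMY.HasDistribution φ X μ := by
  have := M.isClosed
  have := M.starOrderedRing
  have hS : IsStrictlyPositive (X + Y) := hX.add_nonneg hY.nonneg
  -- The von Neumann algebra generated by U, viewed inside M. It contains X + Y = U⁻¹, hence the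
  -- resolvents of X + Y used as test elements.
  let N : Subalgebra ℂ M.toStarSubalgebra :=
    (FreeMY.generatedBy (U : H →L[ℂ] H)).toStarSubalgebra.toSubalgebra.comap
      M.toStarSubalgebra.subtype.toAlgHom
  have hreg : FreeMY.ConstantRegressions φ X Y N c d := by
    refine ⟨?_, fun a ha hu => ?_, fun T hT => ?_, fun T hT => ?_⟩
    · have h1 : X + Y = Ring.inverse U := by
        rw [hU]
        exact (FreeMY.inverse_eq_of_mul_eq_one hS.isUnit.ringInverse
          (Ring.inverse_mul_cancel _ hS.isUnit)).symm
      rw [h1]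
      exact FreeMY.coe_inverse_mem (FreeMY.self_mem_generatedBy _)
        (hU ▸ hS.isUnit.ringInverse)
    · exact FreeMY.coe_inverse_mem (N := FreeMY.generatedBy (U : H →L[ℂ] H)) ha hu
    · rw [← hV]; exact hE.map_mul hc hT
    · rw [← hV]; exact hE.map_mul hd hT
  have hcd := hreg.one_lt_mul hφ hX hY hfree hYnd
  exact ⟨hcd, (φ (Ring.inverse Y)).re, _, _, _, hφ.re_pos hY.ringInverse,
    hφ.eq_re_of_isSelfAdjoint hY.ringInverse.isSelfAdjoint, rfl, rfl, rfl,
    hreg.hasDistribution_freePoisson hφ hX hY hfree hcd rfl rfl,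
    hreg.exists_isFreeGIG hφ hX hY hfree hcd rfl rfl rfl⟩
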